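/- **Setting.** Let $0\le k\le n$. $\mathcal H^k$ is the $k$-dimensional Hausdorff measure on $\mathbb R^n$, $\Lambda_k$ the space of $k$-vectors of $\mathbb R^n$ and $\Lambda^k$ its dual. An *oriented rectifiable set* is an $\mathcal H^k$-measurable, $k$-rectifiable set $S\subset\mathbb R^n$ with $0<\mathcal H^k(S)<\infty$, written up to an $\mathcal H^k$-null set as a countable disjoint union $S_{\rm reg}$ of measurable pieces of embedded $k$-dimensional $C^1$ submanifolds, together with a field $\tau:S\to\Lambda_k$ that is continuous on $S_{\rm reg}$ and is there a simple $k$-vector of Euclidean norm one spanning the tangent space. For a compact set $E\subset\mathbb R^n$ with $E=\overline{\operatorname{int}E}$ (for instance, the closure of a bounded Lipschitz domain), a continuous $k$-form $\omega\in C^0(E,\Lambda^k)$ and an oriented rectifiable set $S\subset E$ put $$T_S(\omega)=\frac1{\mathcal H^k(S)}\int_S\omega,\qquad \int_S\omega:=\int_S\langle\omega(x);\tau(x)\rangle\,d\mathcal H^k(x).$$ A family $\mathcal T=\{T_{S_1},\dots,T_{S_N}\}$ of such averaging functionals is *unisolvent* for an $N$-dimensional subspace $\mathscr V(E)\subset C^0(E,\Lambda^k)$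 if $\omega\in\mathscr V(E)$ and $T_{S_i}(\omega)=0$ for all $i$ imply $\omega=0$. In that case $\mathscr V(E)$ has a unique Lagrange basis $\omega_1,\dots,\omega_N$ with $T_{S_i}(\omega_j)=\delta_{ij}$, and the *Lebesgue constant* is $$\mathscr L(\mathcal T,\mathscr V(E))=\sup_{S}\ \sum_{i=1}^N|T_S(\omega_i)|,$$ the supremum being taken over all oriented rectifiable sets $S\subset E$. **Theorem.** Let $\widehat E\subset\mathbb R^n$ be compact with $\widehat E=\overline{\operatorname{int}\widehat E}$, and let $\varphi:\widehat E\to E$ be a $C^1$ diffeomorphism, i.e. the restriction of a $C^1$ diffeomorphism from an open neighbourhood of $\widehat E$ onto its open image, with $\varphi(\widehat E)=E$. Let $\sigma_1(x)\ge\dots\ge\sigma_n(x)>0$ be the singular values of $D\varphi(x)$, and let $\|\cdot\|_\infty$ be the supremum norm over $\widehat E$. Let $\mathscr V(E)\subset C^0(E,\Lambda^k)$ be an $N$-dimensional subspace and $\mathscr V(\widehat E)=\varphi^*\mathscr V(E)$. Let $\widehat S_1,\dots,\widehat S_N\subset\widehat E$ be oriented rectifiable sets, and let $S_i=\varphi(\widehat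 S_i)$ be oriented rectifiable with the orientation inherited from $\widehat S_i$ via $\varphi$, that is, at $\mathcal H^k$-almost every $x\in\widehat S_i$ the orienting $k$-vector of $S_i$ at $\varphi(x)$ is a positive multiple of the image under $D\varphi(x)$ of that of $\widehat S_i$ at $x$. Put $\mathcal T=\{T_{S_1},\dots,T_{S_N}\}$ and $\widehat{\mathcal T}=\{T_{\widehat S_1},\dots,T_{\widehat S_N}\}$. If $\mathcal T$ is unisolvent for $\mathscr V(E)$, then $\widehat{\mathcal T}$ is unisolvent for $\mathscr V(\widehat E)$ and $$\mathscr L(\mathcal T,\mathscr V(E))\ \le\ \Big\|\prod_{j=1}^k\sigma_j\Big\|_\infty\,\Big\|\prod_{j=n-k+1}^n\sigma_j^{-1}\Big\|_\infty\ \mathscr L(\widehat{\mathcal T},\mathscr V(\widehat E)).$$ -/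

import Mathlib

open MeasureTheory Set TopologicalSpace
open scoped MeasureTheory ENNReal

noncomputable section

namespace FormInterp

/-- The Euclidean space `ℝⁿ`. -/
abbrev Rn (n : ℕ) : Type := EuclideanSpace ℝ (Fin n)

/-- `Λ^k`: alternating `k`-linear forms on `ℝⁿ`. -/
abbrev Covec (n k : ℕ) : Type := (Rn n) [⋀^Fin k]→L[ℝ] ℝ

/-- `Λ_k`: the `k`-vectors of `ℝⁿ`, realised (by finite-dimensional biduality) as the dual of
`Λ^k`. The duality pairing `⟨α; τ⟩` is `τ α`. -/
abbrev Vec (n k : ℕ) : Type := Covec n k →L[ℝ] ℝ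

/-- The simple `k`-vector `v₁ ∧ ⋯ ∧ v_k`; it pairs with `α` to `α (v₁, …, v_k)`. -/
def wedge {n k : ℕ} (v : Fin k → Rn n) : Vec n k :=
  ContinuousAlternatingMap.apply ℝ (Rn n) ℝ v

/-- The map `Λ_k A : Λ_k → Λ_k` induced by a linear map `A`, that is
`v₁ ∧ ⋯ ∧ v_k ↦ A v₁ ∧ ⋯ ∧ A v_k`. -/
def wedgeMap {n k : ℕ} (A : Rn n →L[ℝ] Rn n) (τ : Vec n k) : Vec n k :=
  τ.comp (ContinuousAlternatingMap.compContinuousLinearMapCLM A)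

/-- `τ` is a simple `k`-vector of Euclidean norm one, `τ = c v₁ ∧ ⋯ ∧ v_k`, whose vectors
`v₁, …, v_k` span the set `W`. The squared Euclidean norm of `v₁ ∧ ⋯ ∧ v_k` is the Gram
determinant. (The scalar `c` is only needed for `k = 0`, where `τ = ±1`.) -/
def IsUnitSimple {n k : ℕ} (τ : Vec n k) (W : Set (Rn n)) : Prop :=
  ∃ (c : ℝ) (v : Fin k → Rn n), τ = c • wedge v ∧ c ^ 2 * (Matrix.gram ℝ v).det = 1 ∧
    (Submodule.span ℝ (range v) : Set (Rn n)) = W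

/-- `M` is an embedded `k`-dimensional `C¹` submanifold of `ℝⁿ` (slice charts). -/
def IsC1Submanifold {n : ℕ} (k : ℕ) (M : Set (Rn n)) : Prop :=
  ∀ x ∈ M, ∃ (Φ : OpenPartialHomeomorph (Rn n) (Rn n)) (W : Submodule ℝ (Rn n)),
    x ∈ Φ.source ∧ ContDiffOn ℝ 1 Φ Φ.source ∧ ContDiffOn ℝ 1 Φ.symm Φ.target ∧
    Module.finrank ℝ W = k ∧ ∀ y ∈ Φ.source, (y ∈ M ↔ Φ y ∈ W)

/-- `S` is `k`-rectifiable: up to an `ℋ^k`-null set it is covered by countably many Lipschitz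
images of `ℝ^k`. -/
def IsRectifiable {n : ℕ} (k : ℕ) (S : Set (Rn n)) : Prop :=
  ∃ f : ℕ → Rn k → Rn n, (∀ i, ∃ K, LipschitzWith K (f i)) ∧
    (μHE[k] : Measure (Rn n)) (S \ ⋃ i, range (f i)) = 0

/-- An oriented, `ℋ^k`-measurable, `k`-rectifiable subset of `ℝⁿ` with finite and positive measure
`ℋ^k` (so that averages over it make sense). Up to the null set `carrier \ reg` it is a countable
disjoint union `reg` of measurable pieces of embedded `C¹` submanifolds, and it is oriented by
a field of `k`-vectors which is continuous on `reg` and is there a unit simple `k`-vector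
spanning the tangent space. -/
structure OrientedRectifiable (n k : ℕ) where
  carrier : Set (Rn n)
  measurable : NullMeasurableSet carrier (μHE[k] : Measure (Rn n))
  finite : (μHE[k] : Measure (Rn n)) carrier < ∞
  pos : 0 < (μHE[k] : Measure (Rn n)) carrier
  rectifiable : IsRectifiable k carrier
  reg : Set (Rn n)
  reg_subset : reg ⊆ carrier
  sing_null : (μHE[k] : Measure (Rn n)) (carrier \ reg) = 0
  piece : ℕ → Set (Rn n)
  manifold : ℕ → Set (Rn n)
  reg_eq : reg = ⋃ i, piece i
  piece_disjoint : Pairwise fun i j => Disjoint (piece i) (piece j)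
  piece_measurable : ∀ i, NullMeasurableSet (piece i) (μHE[k] : Measure (Rn n))
  piece_subset : ∀ i, piece i ⊆ manifold i
  isSubmanifold : ∀ i, IsC1Submanifold k (manifold i)
  orientation : Rn n → Vec n k
  orientation_continuousOn : ContinuousOn orientation reg
  orientation_tangent : ∀ i, ∀ x ∈ piece i,
    IsUnitSimple (orientation x) (tangentConeAt ℝ (manifold i) x)

/-- Continuous `k`-forms on the compact set `E`. -/
abbrev TestForm {n : ℕ} (k : ℕ) (E : Compacts (Rn n)) : Type := C(E, Covec n k)

open Classical in
/-- The function `x ↦ ⟨ω(x); τ(x)⟩` on `E` (extended by zero outside `E`). -/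
def pairing {n k : ℕ} (S : OrientedRectifiable n k) {E : Compacts (Rn n)} (ω : TestForm k E)
    (x : Rn n) : ℝ :=
  if h : x ∈ E then S.orientation x (ω ⟨x, h⟩) else 0

/-- `∫_S ω = ∫_S ⟨ω(x); τ(x)⟩ dℋ^k(x)` for `S ⊆ E`. -/
def integralForm {n k : ℕ} (S : OrientedRectifiable n k) {E : Compacts (Rn n)}
    (ω : TestForm k E) : ℝ :=
  ∫ x in S.carrier, pairing S ω x ∂(μHE[k] : Measure (Rn n))

theorem abs_apply_le {n k : ℕ} (α : Covec n k) {c : ℝ} {v : Fin k → Rn n}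
    (h : c ^ 2 * (Matrix.gram ℝ v).det = 1) : |c * α v| ≤ ‖α‖ := by
  have hdet : (Matrix.gram ℝ v).det ≠ 0 := by
    intro h0
    simp [h0] at h
  have hli : LinearIndependent ℝ v := by
    by_contra hni
    obtain ⟨g, hg, i, hi⟩ := Fintype.not_linearIndependent_iff.1 hni
    refine hdet (Matrix.exists_mulVec_eq_zero_iff.1 ⟨g, fun h0 => hi (by simp [h0]), ?_⟩)
    ext j
    have : inner ℝ (v j) (∑ i, g i • v i) = 0 := by simp [hg]
    rw [inner_sum] at this
    simp only [inner_smul_right] at this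
    simp only [Matrix.mulVec, dotProduct, Matrix.gram_apply, Pi.zero_apply]
    rw [← this]
    exact Finset.sum_congr rfl fun i _ => mul_comm _ _
  have hfr : Module.finrank ℝ (Submodule.span ℝ (range v)) = k := by
    simpa using finrank_span_eq_card hli
  let W := Submodule.span ℝ (range v)
  let b : OrthonormalBasis (Fin k) ℝ W := (stdOrthonormalBasis ℝ W).reindex (finCongr hfr)
  let u : Fin k → W := fun i => ⟨v i, Submodule.subset_span ⟨i, rfl⟩⟩
  let M := b.toBasis.toMatrix u
  have hgram : Matrix.gram ℝ v = M.transpose * M := by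
    ext i j
    have h1 : inner ℝ (v i) (v j) = inner ℝ (u i) (u j) := rfl
    rw [Matrix.gram_apply, h1, ← b.sum_inner_mul_inner (u i) (u j)]
    simp only [Matrix.mul_apply, Matrix.transpose_apply, M, Module.Basis.toMatrix_apply,
      OrthonormalBasis.coe_toBasis_repr_apply, OrthonormalBasis.repr_apply_apply]
    exact Finset.sum_congr rfl fun l _ => by rw [real_inner_comm]
  have hα : α v = M.det * α (fun i => (b i : Rn n)) := by
    have := (α.toAlternatingMap.compLinearMap W.subtype).eq_smul_basis_det b.toBasis
    have h2 := congrArg (fun f => f u) this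
    simp only [AlternatingMap.smul_apply, Module.Basis.det_apply, smul_eq_mul] at h2
    have h3 : (α.toAlternatingMap.compLinearMap W.subtype) u = α v := rfl
    rw [h3] at h2
    rw [h2, mul_comm]
    congr 1
  have hc : |c * M.det| = 1 := by
    rw [hgram, Matrix.det_mul, Matrix.det_transpose] at h
    have : (c * M.det) ^ 2 = 1 := by rw [← h]; ring
    rcases (pow_eq_one_iff_cases.1 this) with h1 | h1 | h1 <;> simp_all
  calc |c * α v| = |c * M.det| * |α (fun i => (b i : Rn n))| := by
        rw [hα, ← mul_assoc, abs_mul]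
    _ ≤ ‖α‖ := by
        rw [hc, one_mul]
        have h1 := α.le_opNorm (fun i => (b i : Rn n))
        have h2 : ∀ i, ‖(b i : Rn n)‖ = 1 := fun i => b.orthonormal.1 i
        simpa only [h2, Finset.prod_const_one, mul_one, Real.norm_eq_abs] using h1

theorem integrableOn_pairing {n k : ℕ} (S : OrientedRectifiable n k) {E : Compacts (Rn n)}
    (ω : TestForm k E) :
    IntegrableOn (pairing S ω) S.carrier (μHE[k] : Measure (Rn n)) := by
  classical
  set μ : Measure (Rn n) := μHE[k]
  have hregm : NullMeasurableSet S.reg μ := by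
    rw [S.reg_eq]
    exact NullMeasurableSet.iUnion S.piece_measurable
  obtain ⟨R, hRS, hRm, hRe⟩ := hregm.exists_measurable_subset_ae_eq
  have hreg : S.reg =ᵐ[μ] S.carrier :=
    (ae_eq_set.2 ⟨by rw [sdiff_eq_empty.2 S.reg_subset]; simp, S.sing_null⟩)
  have hR : μ.restrict R = μ.restrict S.carrier := Measure.restrict_congr_set (hRe.trans hreg)
  have hEm : MeasurableSet (E : Set (Rn n)) := E.isCompact.measurableSet
  have hcont : ContinuousOn (pairing S ω) (R ∩ E) := by
    rw [continuousOn_iff_continuous_domRestrict]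
    have h1 : Continuous fun x : ↥(R ∩ (E : Set (Rn n))) => S.orientation x :=
      continuousOn_iff_continuous_domRestrict.1
        (S.orientation_continuousOn.mono fun x hx => hRS hx.1)
    have h2 : Continuous fun x : ↥(R ∩ (E : Set (Rn n))) => ω ⟨x, x.2.2⟩ :=
      ω.continuous.comp (by fun_prop)
    have h3 := h1.clm_apply h2
    convert h3 using 1
    ext x
    have hx : (x : Rn n) ∈ E := x.2.2
    simp [pairing, hx]
  have hmeas : AEStronglyMeasurable (pairing S ω) (μ.restrict R) := by
    have h1 : AEStronglyMeasurable (pairing S ω) (μ.restrict (R ∩ E)) :=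
      hcont.aestronglyMeasurable (hRm.inter hEm)
    have h2 : AEStronglyMeasurable (pairing S ω) (μ.restrict (R \ E)) := by
      refine (aestronglyMeasurable_const (b := (0 : ℝ))).congr ?_
      filter_upwards [ae_restrict_mem (hRm.diff hEm)] with x hx
      have : x ∉ E := hx.2
      simp [pairing, this]
    have h3 := aestronglyMeasurable_union_iff.2 ⟨h1, h2⟩
    rwa [inter_union_sdiff] at h3
  have hbound : ∀ x ∈ R, ‖pairing S ω x‖ ≤ ‖ω‖ := by
    intro x hx
    have hx' := hRS hx
    rw [S.reg_eq] at hx'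
    obtain ⟨i, hi⟩ := mem_iUnion.1 hx'
    obtain ⟨c, v, hτ, hn, -⟩ := S.orientation_tangent i x hi
    by_cases hE : x ∈ E
    · have h1 : pairing S ω x = c * ω ⟨x, hE⟩ v := by
        simp [pairing, hE, hτ, wedge]
      rw [h1, Real.norm_eq_abs]
      exact (abs_apply_le _ hn).trans (ω.norm_coe_le_norm _)
    · have h1 : pairing S ω x = 0 := by simp [pairing, hE]
      rw [h1, norm_zero]
      exact norm_nonneg ω
  have hfin : μ R < ∞ := lt_of_le_of_lt (measure_mono (hRS.trans S.reg_subset)) S.finite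
  rw [IntegrableOn, ← hR]
  exact IntegrableOn.of_bound hfin hmeas ‖ω‖
    ((ae_restrict_mem hRm).mono fun x hx => hbound x hx)

/-- The averaging current `T_S(ω) = (1 / ℋ^k(S)) ∫_S ω`. -/
def avgCurrent {n k : ℕ} (S : OrientedRectifiable n k) (E : Compacts (Rn n)) :
    TestForm k E →ₗ[ℝ] ℝ where
  toFun ω := ((μHE[k] : Measure (Rn n)) S.carrier).toReal⁻¹ * integralForm S ω
  map_add' ω η := by
    rw [← mul_add]
    congr 1
    rw [integralForm, integralForm, integralForm,
      ← integral_add (integrableOn_pairing S ω) (integrableOn_pairing S η)]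
    congr 1
    ext x
    by_cases h : x ∈ E <;> simp [pairing, h]
  map_smul' c ω := by
    have : integralForm S (c • ω) = c * integralForm S ω := by
      rw [integralForm, integralForm, ← integral_const_mul]
      congr 1
      ext x
      by_cases h : x ∈ E <;> simp [pairing, h]
    simp only [this, RingHom.id_apply, smul_eq_mul]
    ring

/-- `T_1, …, T_N` is unisolvent for `V`: `dim V = N`, and `ω ∈ V` vanishes as soon as
all `T_i(ω)` vanish. -/
def IsUnisolvent {n k N : ℕ} {E : Compacts (Rn n)} (V : Submodule ℝ (TestForm k E))
    (T : Fin N → TestForm k E →ₗ[ℝ] ℝ) : Prop :=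
  FiniteDimensional ℝ V ∧ Module.finrank ℝ V = N ∧ ∀ ω ∈ V, (∀ i, T i ω = 0) → ω = 0

theorem IsUnisolvent.existsUnique {n k N : ℕ} {E : Compacts (Rn n)}
    {V : Submodule ℝ (TestForm k E)} {T : Fin N → TestForm k E →ₗ[ℝ] ℝ}
    (h : IsUnisolvent V T) (j : Fin N) :
    ∃! ω : V, ∀ i, T i (ω : TestForm k E) = if i = j then 1 else 0 := by
  obtain ⟨hfd, hN, hdet⟩ := h
  let L : V →ₗ[ℝ] (Fin N → ℝ) := LinearMap.pi fun i => (T i).comp V.subtype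
  have hinj : Function.Injective L := by
    intro ω η hωη
    refine Subtype.ext (sub_eq_zero.1 (hdet _ (V.sub_mem ω.2 η.2) fun i => ?_))
    rw [map_sub, sub_eq_zero]
    exact congrFun hωη i
  have hsurj : Function.Surjective L :=
    (LinearMap.injective_iff_surjective_of_finrank_eq_finrank (K := ℝ) (V := V)
      (V₂ := Fin N → ℝ) (by rw [hN]; simp)).1 hinj
  obtain ⟨ω, hω⟩ := hsurj fun i => if i = j then 1 else 0
  exact ⟨ω, fun i => congrFun hω i, fun η hη => hinj (hω ▸ funext hη)⟩

/-- The Lagrange basis `ω_1, …, ω_N` of `V` relative to `T_1, …, T_N`: `T_i(ω_j) = δ_ij`. -/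
def lagrangeBasis {n k N : ℕ} {E : Compacts (Rn n)} {V : Submodule ℝ (TestForm k E)}
    {T : Fin N → TestForm k E →ₗ[ℝ] ℝ} (h : IsUnisolvent V T) (j : Fin N) : TestForm k E :=
  ((h.existsUnique j).choose : V)

/-- The Lebesgue constant: the supremum of `∑ i, |T(ω_i)|` over all averaging currents `T` of
oriented rectifiable sets contained in `E`. -/
def lebesgueConstant {n k N : ℕ} {E : Compacts (Rn n)} {V : Submodule ℝ (TestForm k E)}
    {T : Fin N → TestForm k E →ₗ[ℝ] ℝ} (h : IsUnisolvent V T) : ℝ≥0∞ :=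
  ⨆ (S : OrientedRectifiable n k) (_ : S.carrier ⊆ E),
    ENNReal.ofReal (∑ i, |avgCurrent S E (lagrangeBasis h i)|)

/-- A `C¹` diffeomorphism from `F` onto `E`: a `C¹` diffeomorphism from an open
neighbourhood of `F` onto its open image, which maps `F` onto `E`. -/
structure C1Diffeo {n : ℕ} (F E : Compacts (Rn n)) where
  toHomeo : OpenPartialHomeomorph (Rn n) (Rn n)
  contDiffOn : ContDiffOn ℝ 1 toHomeo toHomeo.source
  contDiffOn_symm : ContDiffOn ℝ 1 toHomeo.symm toHomeo.target
  subset_source : (F : Set (Rn n)) ⊆ toHomeo.source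
  image_eq : toHomeo '' (F : Set (Rn n)) = E

/-- The differential `Dφ(x)`. -/
def C1Diffeo.D {n : ℕ} {F E : Compacts (Rn n)} (φ : C1Diffeo F E) (x : Rn n) :
    Rn n →L[ℝ] Rn n :=
  fderiv ℝ φ.toHomeo x

theorem C1Diffeo.mem {n : ℕ} {F E : Compacts (Rn n)} (φ : C1Diffeo F E) (x : F) :
    φ.toHomeo x ∈ E := by
  have : φ.toHomeo x ∈ (E : Set (Rn n)) := φ.image_eq ▸ mem_image_of_mem _ x.2
  exact this

theorem C1Diffeo.continuous_D {n : ℕ} {F E : Compacts (Rn n)} (φ : C1Diffeo F E) :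
    Continuous fun x : F => φ.D x := by
  have h := (φ.contDiffOn.continuousOn_fderiv_of_isOpen φ.toHomeo.open_source le_rfl).mono
    φ.subset_source
  exact continuousOn_iff_continuous_domRestrict.1 h

theorem C1Diffeo.continuous_map {n : ℕ} {F E : Compacts (Rn n)} (φ : C1Diffeo F E) :
    Continuous fun x : F => (⟨φ.toHomeo x, φ.mem x⟩ : E) :=
  Continuous.subtype_mk (continuousOn_iff_continuous_domRestrict.1
    (φ.contDiffOn.continuousOn.mono φ.subset_source)) _

/-- The pullback `(φ^* ω)(x)(v_1, …, v_k) = ω(φ(x))(Dφ(x) v_1, …, Dφ(x) v_k)`. -/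
def C1Diffeo.pullback {n : ℕ} (k : ℕ) {F E : Compacts (Rn n)} (φ : C1Diffeo F E) :
    TestForm k E →ₗ[ℝ] TestForm k F where
  toFun ω :=
    { toFun := fun x => (ω ⟨φ.toHomeo x, φ.mem x⟩).compContinuousLinearMap (φ.D x)
      continuous_toFun := by
        have h := (ContinuousAlternatingMap.continuous_compContinuousLinearMapCLM
          (𝕜 := ℝ) (ι := Fin k) (E := Rn n) (F := Rn n) (G := ℝ)).comp φ.continuous_D
        exact h.clm_apply (ω.continuous.comp φ.continuous_map) }
  map_add' _ _ := rfl
  map_smul' _ _ := rfl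

/-- `S` is the image `φ(R)` with the orientation inherited from `R` via `φ`: at almost every
point, the orienting `k`-vector of `S` is the normalised image under `Dφ` of the one of `R`. -/
def IsOrientedImage {n k : ℕ} {F E : Compacts (Rn n)} (φ : C1Diffeo F E)
    (R S : OrientedRectifiable n k) : Prop :=
  S.carrier = φ.toHomeo '' R.carrier ∧
    ∀ᵐ x ∂((μHE[k] : Measure (Rn n)).restrict R.carrier),
      ∃ c : ℝ, 0 < c ∧ S.orientation (φ.toHomeo x) = c • wedgeMap (φ.D x) (R.orientation x)

/-- The singular values `σ_1 ≥ ⋯ ≥ σ_n` of `Dφ(x)`. -/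
def C1Diffeo.sigma {n : ℕ} {F E : Compacts (Rn n)} (φ : C1Diffeo F E) (j : ℕ) (x : Rn n) : ℝ :=
  (φ.D x : Rn n →ₗ[ℝ] Rn n).singularValues (j - 1)

/-- The sup norm over `F`. -/
def supNorm {n : ℕ} (F : Compacts (Rn n)) (f : Rn n → ℝ) : ℝ≥0∞ :=
  ⨆ x ∈ F, ENNReal.ofReal |f x|

end FormInterp

end

/-! Pullback turns averages over `S = φ(R)` into averages over `R`, up to a positive factor. As the
orientation is inherited, `∫_S ω = ∫_R φ^*ω` (`IsOrientedImage.integralForm_eq`), hence `T_R(φ^*ω) =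
(ℋ^k(S) / ℋ^k(R)) T_S(ω)`. Positive factors do not affect unisolvence, and they give `φ^*ω_i = r_i
ω̂_i` for the two Lagrange bases, with `r_i = ℋ^k(S_i) / ℋ^k(Ŝ_i)`.

Every oriented rectifiable `S ⊆ E` is the oriented image of `R = φ⁻¹(S)`
(`C1Diffeo.exists_isOrientedImage`), so `T_S(ω_i) = (ℋ^k(R) / ℋ^k(S)) r_i T_R(ω̂_i)`. It remains to
bound the two measure ratios. By the area formula, `ℋ^k(φ(R))` is the integral over `R` of the
Jacobian of `Dφ` on tangent planes. On any `k`-plane this Jacobian lies between the products of the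
`k` smallest and of the `k` largest singular values (`IsUnitSimple.mass_wedgeMap_mem_Icc`). The
first ratio is thus at most the second supremum, and each `r_i` at most the first.

The analytic core is the area formula `measure_image_piece_eq_lintegral`. Near a point of a `C¹`
submanifold, projection to the tangent plane is nearly isometric and `φ` is nearly `Dφ` after that
projection, so `φ` scales `ℋ^k` by the Jacobian up to a factor `C > 1`. A countable partition
globalises this, and `C → 1` gives equality. The Jacobian is written as the mass of `(Λ_k Dφ) τ`,
the same number that normalises the transported orientation; this is why the two cancel in the
integral of a form. -/

namespace FormInterp

/-! ### Jacobians on `k`-planes: mass, Gram determinants and singular values. -/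

section LinearAlgebra

/-- The operator norm of a functional on a normed space. On `Λ_k` this is the mass norm, which
agrees with the Euclidean norm on simple `k`-vectors. -/
noncomputable def mass {F : Type*} [NormedAddCommGroup F] [NormedSpace ℝ F] (τ : F →L[ℝ] ℝ) : ℝ := ‖τ‖

section

variable {F : Type*} [NormedAddCommGroup F] [NormedSpace ℝ F]

theorem mass_nonneg (τ : F →L[ℝ] ℝ) : 0 ≤ mass τ := norm_nonneg τ

theorem mass_smul (c : ℝ) (τ : F →L[ℝ] ℝ) : mass (c • τ) = |c| * mass τ := norm_smul c τ

theorem continuous_mass : Continuous (mass : (F →L[ℝ] ℝ) → ℝ) := continuous_norm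

theorem mass_le {τ : F →L[ℝ] ℝ} {C : ℝ} (hC : 0 ≤ C) (h : ∀ α, |τ α| ≤ C * ‖α‖) : mass τ ≤ C :=
  τ.opNorm_le_bound hC h

theorem abs_apply_le_mass (τ : F →L[ℝ] ℝ) (α : F) : |τ α| ≤ mass τ * ‖α‖ := τ.le_opNorm α

end

/-- A symmetrised Cauchy–Binet formula: the sum runs over all maps of indices. -/
theorem factorial_mul_det_transpose_mul_diagonal_mul {n k : ℕ} (C : Matrix (Fin n) (Fin k) ℝ)
    (d : Fin n → ℝ) :
    (k.factorial : ℝ) * (C.transpose * Matrix.diagonal d * C).det =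
      ∑ s : Fin k → Fin n, (∏ i, d (s i)) * (C.submatrix s id).det ^ 2 := by
  have h1 : (C.transpose * Matrix.diagonal d * C).det =
      ∑ s : Fin k → Fin n, (∏ i, C (s i) i * d (s i)) * (C.submatrix s id).det := by
    have h2 : C.transpose * Matrix.diagonal d * C =
        fun i => ∑ l : Fin n, (C l i * d l) • C l := by
      ext i j
      rw [Matrix.mul_apply]
      simp [Matrix.mul_diagonal, Finset.sum_apply]
    rw [h2]
    change (Matrix.detRowAlternating (n := Fin k) (R := ℝ)).toMultilinearMap _ = _
    rw [MultilinearMap.map_sum]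
    refine Finset.sum_congr rfl fun s _ => ?_
    rw [MultilinearMap.map_smul_univ]
    rfl
  -- Substituting `s ∘ σ` for `s` permutes the rows of the submatrix, which costs the sign of `σ`.
  -- Summing over all `σ` then assembles the second determinant from its Leibniz expansion.
  have h3 : ∀ σ : Equiv.Perm (Fin k), (C.transpose * Matrix.diagonal d * C).det =
      ∑ s : Fin k → Fin n, (∏ i, d (s i)) * (C.submatrix s id).det *
        ((Equiv.Perm.sign σ : ℤ) * ∏ i, C (s (σ i)) i) := by
    intro σ
    rw [h1, ← (Equiv.arrowCongr σ (Equiv.refl (Fin n))).symm.sum_comp]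
    refine Finset.sum_congr rfl fun s _ => ?_
    have h4 : (Equiv.arrowCongr σ (Equiv.refl (Fin n))).symm s = s ∘ σ := by
      ext i; simp [Equiv.arrowCongr]
    have h5 : (C.submatrix (s ∘ σ) id).det = (Equiv.Perm.sign σ : ℤ) * (C.submatrix s id).det := by
      rw [← Matrix.det_permute]
      rfl
    rw [h4, h5, Finset.prod_mul_distrib]
    simp only [Function.comp_apply]
    rw [Equiv.prod_comp σ fun i => d (s i)]
    ring
  have h6 : (k.factorial : ℝ) * (C.transpose * Matrix.diagonal d * C).det =
      ∑ _σ : Equiv.Perm (Fin k), (C.transpose * Matrix.diagonal d * C).det := by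
    simp [Fintype.card_perm]
  rw [h6, Finset.sum_congr rfl fun σ _ => h3 σ, Finset.sum_comm]
  refine Finset.sum_congr rfl fun s _ => ?_
  rw [← Finset.mul_sum, sq, ← mul_assoc]
  congr 1
  rw [Matrix.det_apply]
  refine Finset.sum_congr rfl fun σ _ => ?_
  simp [Units.smul_def]

/-- Once sorted, the indices increase strictly, so the `m`-th one is at least `m` and the antitone
`d` is at most `d m` there. -/
theorem prod_comp_le_of_injective {n k : ℕ} {d : ℕ → ℝ} (hd : Antitone d) (h0 : ∀ i, 0 ≤ d i)
    {s : Fin k → Fin n} (hs : Function.Injective s) :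
    ∏ i, d (s i) ≤ ∏ j ∈ Finset.range k, d j := by
  have hm : StrictMono (s ∘ Tuple.sort s) :=
    (Tuple.monotone_sort s).strictMono_of_injective (hs.comp (Equiv.injective _))
  rw [← Equiv.prod_comp (Tuple.sort s), Finset.prod_range]
  refine Finset.prod_le_prod (fun _ _ => h0 _) fun i _ => hd ?_
  have : ∀ m (hmk : m < k), m ≤ (s (Tuple.sort s ⟨m, hmk⟩) : ℕ) := by
    intro m
    induction m with
    | zero => simp
    | succ m ih =>
      intro hmk
      have h1 := ih (by omega)
      have h2 : s (Tuple.sort s ⟨m, by omega⟩) < s (Tuple.sort s ⟨m + 1, hmk⟩) :=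
        hm (Fin.mk_lt_mk.2 (Nat.lt_succ_self m))
      exact Nat.succ_le_of_lt (h1.trans_lt h2)
  exact this i i.2

theorem le_prod_comp_of_injective {n k : ℕ} {d : ℕ → ℝ} (hd : Antitone d) (h0 : ∀ i, 0 ≤ d i)
    {s : Fin k → Fin n} (hs : Function.Injective s) :
    ∏ j ∈ Finset.range k, d (n - k + j) ≤ ∏ i, d (s i) := by
  have hm : StrictMono (s ∘ Tuple.sort s) :=
    (Tuple.monotone_sort s).strictMono_of_injective (hs.comp (Equiv.injective _))
  rw [← Equiv.prod_comp (Tuple.sort s), Finset.prod_range]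
  refine Finset.prod_le_prod (fun _ _ => h0 _) fun i _ => hd ?_
  -- Counting down from the last index: `k` strictly increasing values below `n` leave room for `m`
  -- more above the one in position `k - 1 - m`.
  have : ∀ m (hmk : m < k), (s (Tuple.sort s ⟨k - 1 - m, by omega⟩) : ℕ) + m + 1 ≤ n := by
    intro m
    induction m with
    | zero => intro hmk; have := (s (Tuple.sort s ⟨k - 1 - 0, by omega⟩)).2; omega
    | succ m ih =>
      intro hmk
      have h1 := ih (by omega)
      have h2 : s (Tuple.sort s ⟨k - 1 - (m + 1), by omega⟩) <
          s (Tuple.sort s ⟨k - 1 - m, by omega⟩) :=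
        hm (Fin.mk_lt_mk.2 (by omega))
      have h3 : (s (Tuple.sort s ⟨k - 1 - (m + 1), by omega⟩) : ℕ) <
          s (Tuple.sort s ⟨k - 1 - m, by omega⟩) := h2
      omega
  have h1 := this (k - 1 - i) (by omega)
  have h2 : (⟨k - 1 - (k - 1 - i), by omega⟩ : Fin k) = i := Fin.ext (by simp; omega)
  rw [h2] at h1
  omega

/-- For `D : ℝⁿ → ℝⁿ` and `b₁, …, b_k` orthonormal, the Gram determinant of `D b₁, …, D b_k`
lies between the products of the `k` smallest and the `k` largest squared singular values. -/
theorem det_gram_comp_mem_Icc {n k : ℕ} (D : Rn n →ₗ[ℝ] Rn n) {b : Fin k → Rn n}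
    (hb : Orthonormal ℝ b) :
    (Matrix.gram ℝ fun i => D (b i)).det ∈
      Icc (∏ j ∈ Finset.range k, D.singularValues (n - k + j) ^ 2)
        (∏ j ∈ Finset.range k, D.singularValues j ^ 2) := by
  have hn : Module.finrank ℝ (Rn n) = n := by simp
  -- In an orthonormal eigenbasis of `D* D`, with `C` the coordinates of `b`, the Gram matrix is `Cᵀ
  -- diag(σ²) C`.
  set u := D.isSymmetric_adjoint_comp_self.eigenvectorBasis hn with hu
  set C : Matrix (Fin n) (Fin k) ℝ := fun l i => inner ℝ (u l) (b i) with hC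
  set dd : ℕ → ℝ := fun j => D.singularValues j ^ 2 with hdd
  have hanti : Antitone dd := fun i j hij =>
    pow_le_pow_left₀ (D.singularValues_nonneg j) (D.singularValues_antitone hij) 2
  have hnn : ∀ i, 0 ≤ dd i := fun i => sq_nonneg _
  have hgram : (Matrix.gram ℝ fun i => D (b i)) =
      C.transpose * Matrix.diagonal (fun l : Fin n => dd l) * C := by
    ext i j
    rw [Matrix.mul_apply]
    simp only [Matrix.gram_apply, Matrix.mul_diagonal, Matrix.transpose_apply]
    rw [← LinearMap.adjoint_inner_right, ← u.sum_inner_mul_inner (b i)]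
    refine Finset.sum_congr rfl fun l _ => ?_
    have h1 : inner ℝ (u l) ((LinearMap.adjoint D) (D (b j))) = dd l * inner ℝ (u l) (b j) := by
      have h2 := D.isSymmetric_adjoint_comp_self (u l) (b j)
      rw [LinearMap.comp_apply, LinearMap.comp_apply] at h2
      rw [← h2]
      have h3 := D.isSymmetric_adjoint_comp_self.apply_eigenvectorBasis hn l
      rw [LinearMap.comp_apply] at h3
      rw [hu, h3, inner_smul_left]
      simp [hdd, D.sq_singularValues_fin hn]
    rw [h1, hC, real_inner_comm]
    ring
  have hone : C.transpose * Matrix.diagonal (fun _ : Fin n => (1 : ℝ)) * C = 1 := by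
    ext i j
    rw [Matrix.mul_apply]
    simp only [Matrix.mul_diagonal, Matrix.transpose_apply, mul_one]
    have h1 := u.sum_inner_mul_inner (b i) (b j)
    rw [orthonormal_iff_ite.1 hb i j] at h1
    rw [Matrix.one_apply, ← h1]
    exact Finset.sum_congr rfl fun l _ => by rw [hC, real_inner_comm]
  have h1 := factorial_mul_det_transpose_mul_diagonal_mul C (fun l => dd l)
  -- Unit weights give the normalisation: the squared minors sum to `k!`. So the Gram determinant is
  -- a weighted mean of products of squared singular values, in which only injective `s` count.
  have h2 := factorial_mul_det_transpose_mul_diagonal_mul C (fun _ => 1)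
  rw [hone, Matrix.det_one, mul_one] at h2
  simp only [Finset.prod_const_one, one_mul] at h2
  have hk : (0 : ℝ) < k.factorial := by positivity
  have hninj : ∀ s : Fin k → Fin n, ¬ Function.Injective s → (C.submatrix s id).det = 0 := by
    intro s hs
    simp only [Function.Injective, not_forall] at hs
    obtain ⟨i, j, hij, hne⟩ := hs
    exact Matrix.det_zero_of_row_eq hne (by ext l; simp [hij])
  rw [hgram]
  constructor
  · refine le_of_mul_le_mul_left ?_ hk
    rw [h1, h2, Finset.sum_mul]
    refine Finset.sum_le_sum fun s _ => ?_
    by_cases hs : Function.Injective s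
    · rw [mul_comm]
      exact mul_le_mul_of_nonneg_right (le_prod_comp_of_injective hanti hnn hs) (sq_nonneg _)
    · simp [hninj s hs]
  · refine le_of_mul_le_mul_left ?_ hk
    rw [h1, h2, Finset.sum_mul]
    refine Finset.sum_le_sum fun s _ => ?_
    by_cases hs : Function.Injective s
    · rw [mul_comm (_ ^ 2)]
      exact mul_le_mul_of_nonneg_right (prod_comp_le_of_injective hanti hnn hs) (sq_nonneg _)
    · simp [hninj s hs]

theorem det_gram_eq_sq_det {k : ℕ} {W : Type*} [NormedAddCommGroup W] [InnerProductSpace ℝ W]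
    (b : OrthonormalBasis (Fin k) ℝ W) (u : Fin k → W) :
    (Matrix.gram ℝ u).det = b.toBasis.det u ^ 2 := by
  have hgram : Matrix.gram ℝ u = (b.toBasis.toMatrix u).transpose * b.toBasis.toMatrix u := by
    ext i j
    rw [Matrix.gram_apply, ← b.sum_inner_mul_inner (u i) (u j)]
    simp only [Matrix.mul_apply, Matrix.transpose_apply, Module.Basis.toMatrix_apply,
      OrthonormalBasis.coe_toBasis_repr_apply, OrthonormalBasis.repr_apply_apply]
    exact Finset.sum_congr rfl fun l _ => by rw [real_inner_comm]
  rw [hgram, Matrix.det_mul, Matrix.det_transpose, Module.Basis.det_apply, sq]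

theorem linearIndependent_of_det_gram_ne_zero {k : ℕ} {W : Type*} [NormedAddCommGroup W]
    [InnerProductSpace ℝ W] {v : Fin k → W} (hdet : (Matrix.gram ℝ v).det ≠ 0) :
    LinearIndependent ℝ v := by
  by_contra hni
  obtain ⟨g, hg, i, hi⟩ := Fintype.not_linearIndependent_iff.1 hni
  refine hdet (Matrix.exists_mulVec_eq_zero_iff.1 ⟨g, fun h0 => hi (by simp [h0]), ?_⟩)
  ext j
  have : inner ℝ (v j) (∑ i, g i • v i) = 0 := by simp [hg]
  rw [inner_sum] at this
  simp only [inner_smul_right] at this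
  simp only [Matrix.mulVec, dotProduct, Matrix.gram_apply, Pi.zero_apply]
  rw [← this]
  exact Finset.sum_congr rfl fun i _ => mul_comm _ _

/-- The upper bound is `abs_apply_le` for the normalised wedge; the lower bound needs a covector of
norm at most one that realises the volume of `v`. -/
theorem mass_wedge {n k : ℕ} {v : Fin k → Rn n} (hv : LinearIndependent ℝ v) :
    0 < (Matrix.gram ℝ v).det ∧ mass (wedge v : Vec n k) = √(Matrix.gram ℝ v).det := by
  set W := Submodule.span ℝ (range v)
  have hfr : Module.finrank ℝ W = k := by simpa using finrank_span_eq_card hv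
  have : Fact (Module.finrank ℝ W = k) := ⟨hfr⟩
  let b : OrthonormalBasis (Fin k) ℝ W := (stdOrthonormalBasis ℝ W).reindex (finCongr hfr)
  let u : Fin k → W := fun i => ⟨v i, Submodule.subset_span ⟨i, rfl⟩⟩
  have hgram : (Matrix.gram ℝ v).det = b.toBasis.det u ^ 2 := by
    rw [← det_gram_eq_sq_det]; rfl
  have hu : LinearIndependent ℝ u := LinearIndependent.of_comp W.subtype hv
  have hne : b.toBasis.det u ≠ 0 := by
    have hsp : Submodule.span ℝ (range u) = ⊤ :=
      hu.span_eq_top_of_card_eq_finrank' (by simp [hfr])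
    exact ((Module.Basis.is_basis_iff_det b.toBasis).1 ⟨hu, hsp⟩).ne_zero
  have hpos : 0 < (Matrix.gram ℝ v).det := by rw [hgram]; positivity
  refine ⟨hpos, le_antisymm ?_ ?_⟩
  · refine mass_le (Real.sqrt_nonneg _) fun α => ?_
    have hs : 0 < √(Matrix.gram ℝ v).det := Real.sqrt_pos.2 hpos
    have h1 := abs_apply_le α (c := (√(Matrix.gram ℝ v).det)⁻¹) (v := v) (by
      rw [inv_pow, Real.sq_sqrt hpos.le, inv_mul_cancel₀ hpos.ne'])
    rw [abs_mul, abs_inv, abs_of_pos hs, inv_mul_le_iff₀ hs] at h1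
    exact h1
  -- The test covector is the volume form of the span precomposed with the orthogonal projection.
  -- Hadamard's inequality and the contractivity of the projection bound its norm by one.
  · let o := b.toBasis.orientation
    let f : (Rn n) [⋀^Fin k]→ₗ[ℝ] ℝ :=
      o.volumeForm.compLinearMap (W.orthogonalProjectionOnto : Rn n →ₗ[ℝ] W)
    let α : Covec n k := f.mkContinuous 1 (by
      intro m
      rw [one_mul]
      refine (o.abs_volumeForm_apply_le _).trans ?_
      exact Finset.prod_le_prod (fun _ _ => norm_nonneg _) fun i _ =>
        W.norm_orthogonalProjectionOnto_apply_le (m i))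
    have hα : ‖α‖ ≤ 1 := f.mkContinuous_norm_le zero_le_one _
    have hαv : α v = o.volumeForm u := by
      change o.volumeForm (fun i => W.orthogonalProjectionOnto (v i)) = _
      congr 1
      ext1 i
      exact Submodule.orthogonalProjectionOnto_mem_subspace_eq_self (u i)
    have h1 : |α v| = √(Matrix.gram ℝ v).det := by
      rw [hgram, Real.sqrt_sq_eq_abs, hαv, o.volumeForm_robust' b]
    rw [← h1]
    calc |α v| ≤ mass (wedge v : Vec n k) * ‖α‖ := abs_apply_le_mass (wedge v : Vec n k) α
      _ ≤ mass (wedge v : Vec n k) := mul_le_of_le_one_right (mass_nonneg _) hα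

theorem IsUnitSimple.exists_linearIndependent {n k : ℕ} {τ : Vec n k} {W : Set (Rn n)}
    (h : IsUnitSimple τ W) : ∃ (c : ℝ) (v : Fin k → Rn n), τ = c • wedge v ∧
      c ^ 2 * (Matrix.gram ℝ v).det = 1 ∧ LinearIndependent ℝ v ∧
      (Submodule.span ℝ (range v) : Set (Rn n)) = W := by
  obtain ⟨c, v, h1, h2, h3⟩ := h
  refine ⟨c, v, h1, h2, linearIndependent_of_det_gram_ne_zero fun h0 => ?_, h3⟩
  simp [h0] at h2

theorem mass_smul_wedge {n k : ℕ} {v : Fin k → Rn n} (hv : LinearIndependent ℝ v) (c : ℝ) :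
    mass (c • wedge v : Vec n k) = √(c ^ 2 * (Matrix.gram ℝ v).det) := by
  rw [mass_smul, (mass_wedge hv).2, Real.sqrt_mul (sq_nonneg c), Real.sqrt_sq_eq_abs]

theorem IsUnitSimple.mass_eq_one {n k : ℕ} {τ : Vec n k} {W : Set (Rn n)}
    (h : IsUnitSimple τ W) : mass τ = 1 := by
  obtain ⟨c, v, h1, h2, h3, -⟩ := h.exists_linearIndependent
  rw [h1, mass_smul_wedge h3, h2, Real.sqrt_one]

theorem wedgeMap_smul_wedge {n k : ℕ} (A : Rn n →L[ℝ] Rn n) (c : ℝ) (v : Fin k → Rn n) :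
    wedgeMap A (c • wedge v : Vec n k) = c • wedge (A ∘ v) := rfl

theorem wedgeMap_smul {n k : ℕ} (A : Rn n →L[ℝ] Rn n) (c : ℝ) (τ : Vec n k) :
    wedgeMap A (c • τ) = c • wedgeMap A τ := rfl

theorem wedgeMap_wedgeMap {n k : ℕ} (A B : Rn n →L[ℝ] Rn n) (τ : Vec n k) :
    wedgeMap A (wedgeMap B τ) = wedgeMap (A.comp B) τ := rfl

theorem wedgeMap_id {n k : ℕ} (τ : Vec n k) : wedgeMap (ContinuousLinearMap.id ℝ (Rn n)) τ = τ :=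
  rfl

theorem IsUnitSimple.wedgeMap_mass_pos {n k : ℕ} {τ : Vec n k} {W : Set (Rn n)}
    (h : IsUnitSimple τ W) {A : Rn n →L[ℝ] Rn n} (hA : Function.Injective A) :
    0 < mass (wedgeMap A τ) := by
  obtain ⟨c, v, h1, h2, h3, -⟩ := h.exists_linearIndependent
  have h4 : LinearIndependent ℝ (A ∘ v) := h3.map' A.toLinearMap (LinearMap.ker_eq_bot.2 hA)
  have hc : c ≠ 0 := by rintro rfl; simp at h2
  rw [h1, wedgeMap_smul_wedge, mass_smul_wedge h4]
  exact Real.sqrt_pos.2 (mul_pos (by positivity) (mass_wedge h4).1)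

/-- The image of a simple `k`-vector is simple, its mass is its Euclidean norm, and injectivity
keeps that norm nonzero. -/
theorem IsUnitSimple.map {n k : ℕ} {τ : Vec n k} {W : Set (Rn n)}
    (h : IsUnitSimple τ W) {A : Rn n →L[ℝ] Rn n} (hA : Function.Injective A) :
    IsUnitSimple ((mass (wedgeMap A τ))⁻¹ • wedgeMap A τ) (A '' W) := by
  have hpos := h.wedgeMap_mass_pos hA
  obtain ⟨c, v, h1, h2, h3, h4⟩ := h.exists_linearIndependent
  have h5 : LinearIndependent ℝ (A ∘ v) := h3.map' A.toLinearMap (LinearMap.ker_eq_bot.2 hA)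
  refine ⟨(mass (wedgeMap A τ))⁻¹ * c, A ∘ v, ?_, ?_, ?_⟩
  · rw [h1, wedgeMap_smul_wedge, smul_smul]
  · have h6 : mass (wedgeMap A τ) ^ 2 = c ^ 2 * (Matrix.gram ℝ (A ∘ v)).det := by
      rw [h1, wedgeMap_smul_wedge, mass_smul_wedge h5, Real.sq_sqrt]
      exact mul_nonneg (sq_nonneg _) (mass_wedge h5).1.le
    rw [mul_pow, mul_assoc, ← h6, inv_pow, inv_mul_cancel₀ (by positivity)]
  · rw [range_comp, ← h4]
    exact congrArg (fun s : Submodule ℝ (Rn n) => (s : Set (Rn n)))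
      (Submodule.map_span A.toLinearMap (range v)).symm

theorem IsUnitSimple.exists_submodule {n k : ℕ} {τ : Vec n k} {W : Set (Rn n)}
    (h : IsUnitSimple τ W) :
    ∃ T : Submodule ℝ (Rn n), (T : Set (Rn n)) = W ∧ Module.finrank ℝ T = k := by
  obtain ⟨c, v, h1, h2, h3, h4⟩ := h.exists_linearIndependent
  exact ⟨_, h4, by simpa using finrank_span_eq_card h3⟩

/-- The Jacobian of `A` on the plane `T` of a unit simple `k`-vector `τ` is the mass of `(Λ_k A) τ`. -/
theorem IsUnitSimple.normDet_eq {n k : ℕ} {τ : Vec n k} {T : Submodule ℝ (Rn n)}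
    (h : IsUnitSimple τ T) {A : Rn n →L[ℝ] Rn n} (hA : Function.Injective A) :
    ((A : Rn n →ₗ[ℝ] Rn n).domRestrict T).normDet = mass (wedgeMap A τ) := by
  obtain ⟨c, v, h1, h2, h3, h4⟩ := h.exists_linearIndependent
  have hT : Submodule.span ℝ (range v) = T := SetLike.coe_injective h4
  have hfr : Module.finrank ℝ T = k := by
    rw [← hT]; simpa using finrank_span_eq_card h3
  have h5 : LinearIndependent ℝ (A ∘ v) := h3.map' A.toLinearMap (LinearMap.ker_eq_bot.2 hA)
  let u : Fin k → T := fun i => ⟨v i, hT ▸ Submodule.subset_span ⟨i, rfl⟩⟩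
  -- The map `f` below sends the standard basis to `v`. Gram determinants give `normDet` of both `f`
  -- and `L ∘ₗ f`; multiplicativity isolates `L.normDet`, and the unit norm of `τ` cancels the
  -- contribution of `f`.
  let e := EuclideanSpace.basisFun (Fin k) ℝ
  let f : Rn k →ₗ[ℝ] T := e.toBasis.constr ℝ u
  have hf : ∀ i, f (e i) = u i := fun i => by
    have := e.toBasis.constr_basis ℝ u i
    rwa [e.coe_toBasis] at this
  have h6 : f.normDet ^ 2 = (Matrix.gram ℝ v).det := by
    have := f.normDet_sq_eq_det_gram e
    simp only [hf] at this
    exact this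
  set L := (A : Rn n →ₗ[ℝ] Rn n).domRestrict T
  have h7 : (L ∘ₗ f).normDet ^ 2 = (Matrix.gram ℝ (A ∘ v)).det := by
    have := (L ∘ₗ f).normDet_sq_eq_det_gram e
    simp only [LinearMap.comp_apply, hf] at this
    exact this
  have h8 : (L ∘ₗ f).normDet = L.normDet * f.normDet :=
    LinearMap.normDet_comp_of_finrank_eq f L (by rw [hfr]; simp)
  rw [h1, wedgeMap_smul_wedge, mass_smul_wedge h5, ← h7, h8]
  have h9 : c ^ 2 * (L.normDet * f.normDet) ^ 2 = L.normDet ^ 2 := by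
    rw [mul_pow, h6]
    linear_combination L.normDet ^ 2 * h2
  rw [h9, Real.sqrt_sq L.normDet_nonneg]

/-- This mass is the Jacobian of `A` on the plane of `τ`, so its square is the Gram determinant of
the image of an orthonormal basis of that plane. -/
theorem IsUnitSimple.mass_wedgeMap_mem_Icc {n k : ℕ} {τ : Vec n k} {W : Set (Rn n)}
    (h : IsUnitSimple τ W) {A : Rn n →L[ℝ] Rn n} (hA : Function.Injective A) :
    mass (wedgeMap A τ) ∈
      Icc (∏ j ∈ Finset.range k, (A : Rn n →ₗ[ℝ] Rn n).singularValues (n - k + j))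
        (∏ j ∈ Finset.range k, (A : Rn n →ₗ[ℝ] Rn n).singularValues j) := by
  obtain ⟨T, rfl, hT⟩ := h.exists_submodule
  let b : OrthonormalBasis (Fin k) ℝ T := (stdOrthonormalBasis ℝ T).reindex (finCongr hT)
  have hb : Orthonormal ℝ fun i => (b i : Rn n) :=
    b.orthonormal.comp_linearIsometry T.subtypeₗᵢ
  have h1 := det_gram_comp_mem_Icc (A : Rn n →ₗ[ℝ] Rn n) hb
  have h2 : mass (wedgeMap A τ) ^ 2 = (Matrix.gram ℝ fun i => A (b i)).det := by
    rw [← h.normDet_eq hA]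
    exact ((A : Rn n →ₗ[ℝ] Rn n).domRestrict T).normDet_sq_eq_det_gram b
  have hnn := (A : Rn n →ₗ[ℝ] Rn n).singularValues_nonneg
  simp only [Finset.prod_pow] at h1
  change (Matrix.gram ℝ fun i => A (b i)).det ∈ _ at h1
  rw [← h2] at h1
  exact ⟨le_of_sq_le_sq h1.1 (mass_nonneg _),
    le_of_sq_le_sq h1.2 (Finset.prod_nonneg fun j _ => hnn j)⟩

end LinearAlgebra

/-! ### The local area formula on `C¹` submanifolds. -/

section AreaFormula

open Filter
open scoped Topology NNReal

/-- On `A` the hypothesis makes `f` a function of `g`, Lipschitz with constant `C` on `g '' A`.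
Stating this for two maps allows a direct comparison of two images of `A`; taking one map to be `id`
recovers the usual bound. -/
theorem euclideanHausdorffMeasure_image_le {X Y Z : Type*} [MetricSpace Y] [MetricSpace Z]
    [MeasurableSpace Y] [BorelSpace Y] [MeasurableSpace Z] [BorelSpace Z] (k : ℕ) {f : X → Y}
    {g : X → Z} {A : Set X} {C : ℝ≥0}
    (h : ∀ x ∈ A, ∀ y ∈ A, dist (f x) (f y) ≤ C * dist (g x) (g y)) :
    (μHE[k] : Measure Y) (f '' A) ≤ (C : ℝ≥0∞) ^ k * (μHE[k] : Measure Z) (g '' A) := by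
  rcases A.eq_empty_or_nonempty with rfl | ⟨a, -⟩
  · simp
  have : Nonempty X := ⟨a⟩
  set r : Z → X := Function.invFunOn g A
  have hr : ∀ x ∈ A, r (g x) ∈ A ∧ g (r (g x)) = g x := fun x hx =>
    ⟨Function.invFunOn_mem ⟨x, hx, rfl⟩, Function.invFunOn_eq ⟨x, hx, rfl⟩⟩
  have himg : f '' A = (f ∘ r) '' (g '' A) := by
    rw [image_image]
    refine image_congr fun x hx => ?_
    have h1 := h x hx _ (hr x hx).1
    rw [(hr x hx).2, dist_self, mul_zero] at h1
    exact dist_le_zero.1 h1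
  have hlip : LipschitzOnWith C (f ∘ r) (g '' A) := by
    refine LipschitzOnWith.of_dist_le_mul ?_
    rintro _ ⟨x, hx, rfl⟩ _ ⟨y, hy, rfl⟩
    have h1 := h _ (hr x hx).1 _ (hr y hy).1
    rwa [(hr x hx).2, (hr y hy).2] at h1
  have h2 := hlip.hausdorffMeasure_image_le (d := k) (Nat.cast_nonneg k)
  rw [← himg, ENNReal.rpow_natCast] at h2
  simp only [Measure.euclideanHausdorffMeasure_def, Measure.smul_apply,
    ENNReal.smul_def, smul_eq_mul]
  rw [mul_left_comm]
  gcongr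

section Diffeo

variable {n : ℕ} {φ : OpenPartialHomeomorph (Rn n) (Rn n)}

theorem hasStrictFDerivAt_of_contDiffOn (h : ContDiffOn ℝ 1 φ φ.source) {x : Rn n}
    (hx : x ∈ φ.source) : HasStrictFDerivAt φ (fderiv ℝ φ x) x :=
  (h.contDiffAt (φ.open_source.mem_nhds hx)).hasStrictFDerivAt one_ne_zero

theorem fderiv_symm_comp_fderiv (h : ContDiffOn ℝ 1 φ φ.source)
    (h' : ContDiffOn ℝ 1 φ.symm φ.target) {x : Rn n} (hx : x ∈ φ.source) :
    (fderiv ℝ φ.symm (φ x)).comp (fderiv ℝ φ x) = ContinuousLinearMap.id ℝ (Rn n) := by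
  have h1 := (hasStrictFDerivAt_of_contDiffOn h hx).hasFDerivAt
  have h2 := (hasStrictFDerivAt_of_contDiffOn (φ := φ.symm) h' (φ.map_source hx)).hasFDerivAt
  refine (h2.comp x h1).unique ((hasFDerivAt_id x).congr_of_eventuallyEq ?_)
  filter_upwards [φ.open_source.mem_nhds hx] with y hy using φ.left_inv hy

theorem fderiv_injective (h : ContDiffOn ℝ 1 φ φ.source)
    (h' : ContDiffOn ℝ 1 φ.symm φ.target) {x : Rn n} (hx : x ∈ φ.source) :
    Function.Injective (fderiv ℝ φ x) := by
  refine Function.LeftInverse.injective (g := fderiv ℝ φ.symm (φ x)) fun v => ?_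
  exact DFunLike.congr_fun (fderiv_symm_comp_fderiv h h' hx) v

theorem exists_lipschitzOnWith_of_isCompact (h : ContDiffOn ℝ 1 φ φ.source) {K : Set (Rn n)}
    (hK : IsCompact K) (hKs : K ⊆ φ.source) : ∃ C, LipschitzOnWith C φ K := by
  refine LocallyLipschitzOn.exists_lipschitzOnWith_of_compact hK fun x hx => ?_
  obtain ⟨C, s, hs, hC⟩ := (hasStrictFDerivAt_of_contDiffOn h (hKs hx)).exists_lipschitzOnWith
  exact ⟨C, s, mem_nhdsWithin_of_mem_nhds hs, hC⟩

end Diffeo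

/-- Near each of its points, secants of a `C¹` submanifold are almost tangent. -/
theorem IsC1Submanifold.exists_nhds_secant {n k : ℕ} {M : Set (Rn n)} (hM : IsC1Submanifold k M)
    {x : Rn n} (hx : x ∈ M) {T : Submodule ℝ (Rn n)} (hT : (T : Set (Rn n)) = tangentConeAt ℝ M x)
    {δ : ℝ} (hδ : 0 < δ) :
    ∃ U ∈ 𝓝 x, ∀ y ∈ M ∩ U, ∀ z ∈ M ∩ U, ∃ t ∈ T, ‖(y - z) - t‖ ≤ δ * ‖y - z‖ := by
  obtain ⟨Φ, W, hxs, hΦ, hΦ', -, hW⟩ := hM x hx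
  set B := fderiv ℝ Φ.symm (Φ x)
  have hB : HasStrictFDerivAt Φ.symm B (Φ x) :=
    hasStrictFDerivAt_of_contDiffOn (φ := Φ.symm) hΦ' (Φ.map_source hxs)
  -- The segment from `Φ x` in direction `w` stays in `W`, so `w` is tangent there, and the
  -- differential of the inverse chart carries it to a tangent vector of `M`.
  have hBT : ∀ w ∈ W, B w ∈ T := by
    intro w hw
    have h1 : w ∈ tangentConeAt ℝ ((W : Set (Rn n)) ∩ Φ.target) (Φ x) := by
      rw [tangentConeAt_inter_nhds (Φ.open_target.mem_nhds (Φ.map_source hxs))]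
      have hxW := (hW x hxs).1 hx
      have h2 := mem_tangentConeAt_of_segment_subset (s := (W : Set (Rn n)))
        (W.convex.segment_subset hxW (W.add_mem hxW hw))
      simpa using h2
    have h2 := hB.hasFDerivAt.hasFDerivWithinAt.mapsTo_tangent_cone h1
    rw [Φ.left_inv hxs] at h2
    have h3 : B w ∈ (T : Set (Rn n)) := by
      rw [hT]
      refine tangentConeAt_mono ?_ h2
      rintro _ ⟨a, ⟨haW, hat⟩, rfl⟩
      rw [hW _ (Φ.map_target hat), Φ.right_inv hat]
      exact haW
    exact h3
  obtain ⟨K, s, hs, hK⟩ := (hasStrictFDerivAt_of_contDiffOn hΦ hxs).exists_lipschitzOnWith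
  -- `K` converts chart secants into secants of `M`; the added one keeps the denominator positive.
  have hε : 0 < δ / (K + 1) := by positivity
  have h1 := hB.isLittleO.def hε
  obtain ⟨V, hVo, hxV, hV⟩ := exists_nhds_square h1
  refine ⟨Φ.source ∩ s ∩ Φ ⁻¹' V, inter_mem (inter_mem (Φ.open_source.mem_nhds hxs) hs)
    ((Φ.continuousAt hxs).preimage_mem_nhds (hVo.mem_nhds hxV)), ?_⟩
  rintro y ⟨hyM, ⟨hys, hy2⟩, hyV⟩ z ⟨hzM, ⟨hzs, hz2⟩, hzV⟩
  refine ⟨B (Φ y - Φ z), hBT _ (W.sub_mem ((hW y hys).1 hyM) ((hW z hzs).1 hzM)), ?_⟩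
  have h2 := hV (mk_mem_prod hyV hzV)
  simp only [mem_ofPred_eq, Φ.left_inv hys, Φ.left_inv hzs] at h2
  refine h2.trans ?_
  have h3 : ‖Φ y - Φ z‖ ≤ K * ‖y - z‖ := hK.norm_sub_le hy2 hz2
  calc δ / (K + 1) * ‖Φ y - Φ z‖ ≤ δ / (K + 1) * (K * ‖y - z‖) := by gcongr
    _ ≤ δ / (K + 1) * ((K + 1) * ‖y - z‖) := by gcongr; simp
    _ = δ * ‖y - z‖ := by field_simp

theorem exists_one_lt_pow_le (m : ℕ) {C : ℝ≥0} (hC : 1 < C) : ∃ c : ℝ≥0, 1 < c ∧ c ^ m ≤ C := by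
  have h1 : Tendsto (fun c : ℝ≥0 => c ^ m) (𝓝[>] 1) (𝓝 (1 ^ m)) :=
    ((continuous_pow m).tendsto 1).mono_left nhdsWithin_le_nhds
  rw [one_pow] at h1
  obtain ⟨c, hc1, hc2⟩ := ((h1.eventually_lt_const hC).and self_mem_nhdsWithin).exists
  exact ⟨c, hc2, hc1.le⟩

theorem norm_sub_starProjection_le {E : Type*} [NormedAddCommGroup E] [InnerProductSpace ℝ E]
    {T : Submodule ℝ E} [T.HasOrthogonalProjection] {t b : E} (ht : t ∈ T) :
    ‖b - T.starProjection b‖ ≤ ‖b - t‖ := by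
  rw [T.starProjection_minimal b]
  exact ciInf_le ⟨0, by rintro _ ⟨w, rfl⟩; exact norm_nonneg _⟩ (⟨t, ht⟩ : T)

/-- In the application `b` is a secant of `M`, `p` its tangential projection and `a` the secant of
the image. Replacing `D b` for `a`, and then `p` for `b`, each costs `η ‖b‖`. As `‖b‖ ≤ c K ‖D p‖`,
the total is `2 η c K ‖D p‖ = ε ‖D p‖`. The choice `ε = 1 - c⁻¹` serves both directions, since `1 -
ε = c⁻¹` and `1 + ε ≤ c`. -/
theorem norm_le_of_linear_approx {E F : Type*} [NormedAddCommGroup E] [NormedSpace ℝ E]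
    [NormedAddCommGroup F] [NormedSpace ℝ F] {D : E →L[ℝ] F} {K c ε η δ : ℝ}
    (hKD : ∀ v, ‖v‖ ≤ K * ‖D v‖) (hK0 : 0 < K) (hc : 1 < c) (hε : ε = 1 - c⁻¹)
    (hη : η = ε / (2 * c * K)) (hδε : δ ≤ ε) (hDδ : ‖D‖ * δ ≤ η) {a : F} {b p : E}
    (hfD : ‖a - D b‖ ≤ η * ‖b‖) (hP : ‖b - p‖ ≤ δ * ‖b‖) :
    ‖b‖ ≤ c * ‖p‖ ∧ ‖a‖ ≤ c * ‖D p‖ ∧ ‖D p‖ ≤ c * ‖a‖ := by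
  have hc0 : 0 < c := zero_lt_one.trans hc
  have hcinv : c⁻¹ < 1 := inv_lt_one_of_one_lt₀ hc
  have hε0 : 0 < ε := by linarith
  have hη0 : 0 < η := by rw [hη]; positivity
  have hεc : 1 + ε ≤ c := by
    have h1 : c * c⁻¹ = 1 := mul_inv_cancel₀ hc0.ne'
    nlinarith [sq_nonneg (c - 1), inv_pos.2 hc0]
  have hεs : ∀ r : ℝ, ε * r = r - c⁻¹ * r := fun r => by rw [hε]; ring
  have hbp : ‖b‖ ≤ c * ‖p‖ := by
    have h2 : ‖b‖ ≤ ‖b - p‖ + ‖p‖ := by simpa using norm_add_le (b - p) p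
    have h3 : δ * ‖b‖ ≤ ε * ‖b‖ := mul_le_mul_of_nonneg_right hδε (norm_nonneg _)
    rw [← inv_mul_le_iff₀ hc0]
    linarith [hεs ‖b‖]
  have h3 : ‖D (b - p)‖ ≤ η * ‖b‖ := by
    calc ‖D (b - p)‖ ≤ ‖D‖ * ‖b - p‖ := D.le_opNorm _
      _ ≤ ‖D‖ * (δ * ‖b‖) := mul_le_mul_of_nonneg_left hP (norm_nonneg _)
      _ = (‖D‖ * δ) * ‖b‖ := by ring
      _ ≤ η * ‖b‖ := mul_le_mul_of_nonneg_right hDδ (norm_nonneg _)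
  have h5 : ‖b‖ ≤ c * (K * ‖D p‖) := hbp.trans (mul_le_mul_of_nonneg_left (hKD p) hc0.le)
  have h6 : ‖a - D p‖ ≤ ε * ‖D p‖ := by
    have h4 : a - D p = (a - D b) + D (b - p) := by rw [map_sub]; abel
    calc ‖a - D p‖ ≤ η * ‖b‖ + η * ‖b‖ := by
          rw [h4]; exact (norm_add_le _ _).trans (add_le_add hfD h3)
      _ = 2 * η * ‖b‖ := by ring
      _ ≤ 2 * η * (c * (K * ‖D p‖)) := mul_le_mul_of_nonneg_left h5 (by positivity)
      _ = ε * ‖D p‖ := by rw [hη]; field_simp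
  refine ⟨hbp, ?_, ?_⟩
  · have h2 : ‖a‖ ≤ ‖a - D p‖ + ‖D p‖ := by simpa using norm_add_le (a - D p) (D p)
    have h7 : (1 + ε) * ‖D p‖ ≤ c * ‖D p‖ := mul_le_mul_of_nonneg_right hεc (norm_nonneg _)
    linarith
  · have h2 : ‖D p‖ ≤ ‖a - D p‖ + ‖a‖ := by
      have := norm_sub_le a (a - D p)
      rw [sub_sub_cancel] at this
      linarith
    rw [← inv_mul_le_iff₀ hc0]
    linarith [hεs ‖D p‖]

/-- Near a point of a `C¹` submanifold, a map `f` with injective differential `D` is nearly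
isometric to `D` composed with the projection onto the tangent space. -/
theorem IsC1Submanifold.exists_nhds_linear_approx {n k : ℕ} {M : Set (Rn n)}
    (hM : IsC1Submanifold k M) {x : Rn n} (hx : x ∈ M) {T : Submodule ℝ (Rn n)}
    (hT : (T : Set (Rn n)) = tangentConeAt ℝ M x)
    {f : Rn n → Rn n} {D : Rn n →L[ℝ] Rn n} (hf : HasStrictFDerivAt f D x)
    (hD : Function.Injective D) {c : ℝ} (hc : 1 < c) :
    ∃ U ∈ 𝓝 x, ∀ y ∈ M ∩ U, ∀ z ∈ M ∩ U, ‖y - z‖ ≤ c * ‖T.starProjection (y - z)‖ ∧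
      ‖f y - f z‖ ≤ c * ‖D (T.starProjection (y - z))‖ ∧
      ‖D (T.starProjection (y - z))‖ ≤ c * ‖f y - f z‖ := by
  have hc0 : 0 < c := zero_lt_one.trans hc
  obtain ⟨K, hK0, hK⟩ := (LinearMap.injective_iff_antilipschitz (D : Rn n →ₗ[ℝ] Rn n)).1 hD
  have hKD : ∀ v, ‖v‖ ≤ K * ‖D v‖ := fun v => by
    have := hK.le_mul_dist v 0
    rw [map_zero, dist_zero_right, dist_zero_right] at this
    exact this
  have hK0' : (0 : ℝ) < K := hK0
  have hcinv : c⁻¹ < 1 := inv_lt_one_of_one_lt₀ hc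
  obtain ⟨ε, hε⟩ : ∃ ε, ε = 1 - c⁻¹ := ⟨_, rfl⟩
  have hε0 : 0 < ε := by linarith
  obtain ⟨η, hη⟩ : ∃ η, η = ε / (2 * c * K) := ⟨_, rfl⟩
  have hη0 : 0 < η := by rw [hη]; positivity
  obtain ⟨δ, hδ⟩ : ∃ δ, δ = min ε (η / (‖D‖ + 1)) := ⟨_, rfl⟩
  have hδ0 : 0 < δ := by rw [hδ]; exact lt_min hε0 (by positivity)
  have hδε : δ ≤ ε := hδ ▸ min_le_left _ _
  have hDδ : ‖D‖ * δ ≤ η := by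
    have h1 : δ ≤ η / (‖D‖ + 1) := hδ ▸ min_le_right _ _
    rw [le_div_iff₀ (by positivity)] at h1
    linarith
  obtain ⟨U, hU, hsec⟩ := hM.exists_nhds_secant hx hT hδ0
  obtain ⟨V, hVo, hxV, hV⟩ := exists_nhds_square (hf.isLittleO.def hη0)
  refine ⟨U ∩ V, inter_mem hU (hVo.mem_nhds hxV), ?_⟩
  rintro y ⟨hyM, hyU, hyV⟩ z ⟨hzM, hzU, hzV⟩
  have hfD := hV (mk_mem_prod hyV hzV)
  rw [mem_ofPred_eq] at hfD
  have hP : ‖(y - z) - T.starProjection (y - z)‖ ≤ δ * ‖y - z‖ := by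
    obtain ⟨t, ht, h1⟩ := hsec y ⟨hyM, hyU⟩ z ⟨hzM, hzU⟩
    exact (norm_sub_starProjection_le ht).trans h1
  exact norm_le_of_linear_approx hKD hK0' hc hε hη hδε hDδ hfD hP

/-- Near a point of a `C¹` submanifold, a map `f` with injective differential `D` scales
`ℋ^k` on `M` by nearly the Jacobian of `D` on the tangent space. -/
theorem IsC1Submanifold.exists_nhds_measure_image {n k : ℕ} {M : Set (Rn n)}
    (hM : IsC1Submanifold k M) {x : Rn n} (hx : x ∈ M) {T : Submodule ℝ (Rn n)}
    (hT : (T : Set (Rn n)) = tangentConeAt ℝ M x) (hTk : Module.finrank ℝ T = k)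
    {f : Rn n → Rn n} {D : Rn n →L[ℝ] Rn n} (hf : HasStrictFDerivAt f D x)
    (hD : Function.Injective D) {C : ℝ≥0} (hC : 1 < C) :
    ∃ U ∈ 𝓝 x, ∀ A ⊆ M ∩ U,
      (μHE[k] : Measure (Rn n)) (f '' A) ≤
        C * (ENNReal.ofReal ((D : Rn n →ₗ[ℝ] Rn n).domRestrict T).normDet *
          (μHE[k] : Measure (Rn n)) A) ∧
      ENNReal.ofReal ((D : Rn n →ₗ[ℝ] Rn n).domRestrict T).normDet *
          (μHE[k] : Measure (Rn n)) A ≤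
        C * (μHE[k] : Measure (Rn n)) (f '' A) := by
  -- A factor `c ^ k` is lost in projecting to the tangent plane and another in replacing `f` by its
  -- linearisation.
  obtain ⟨c, hc, hcC⟩ := exists_one_lt_pow_le (2 * k) hC
  obtain ⟨U, hU, happ⟩ := hM.exists_nhds_linear_approx hx hT hf hD
    (c := c) (by exact_mod_cast hc)
  set P : Rn n →L[ℝ] T := T.orthogonalProjectionOnto
  set L := (D : Rn n →ₗ[ℝ] Rn n).domRestrict T
  obtain ⟨h, hhdef⟩ : ∃ h : Rn n → Rn n, h = fun y => L (P y) := ⟨_, rfl⟩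
  have hh : ∀ y z, h y - h z = D (T.starProjection (y - z)) := fun y z => by
    rw [hhdef, Submodule.starProjection_apply]
    change L (P y) - L (P z) = L (P (y - z))
    rw [map_sub, map_sub]
  refine ⟨U, hU, fun A hA => ?_⟩
  have hfh : (μHE[k] : Measure (Rn n)) (f '' A) ≤
      (c : ℝ≥0∞) ^ k * (μHE[k] : Measure (Rn n)) (h '' A) := by
    refine euclideanHausdorffMeasure_image_le k fun y hy z hz => ?_
    rw [dist_eq_norm, dist_eq_norm, hh]
    exact (happ y (hA hy) z (hA hz)).2.1
  have hhf : (μHE[k] : Measure (Rn n)) (h '' A) ≤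
      (c : ℝ≥0∞) ^ k * (μHE[k] : Measure (Rn n)) (f '' A) := by
    refine euclideanHausdorffMeasure_image_le k fun y hy z hz => ?_
    rw [dist_eq_norm, dist_eq_norm, hh]
    exact (happ y (hA hy) z (hA hz)).2.2
  have hPA : (μHE[k] : Measure T) (P '' A) ≤ (μHE[k] : Measure (Rn n)) A := by
    have h1 := euclideanHausdorffMeasure_image_le k (f := P) (g := id) (A := A) (C := 1)
      fun y _ z _ => by
        rw [NNReal.coe_one, one_mul, dist_eq_norm, dist_eq_norm, ← map_sub]
        exact T.norm_orthogonalProjectionOnto_apply_le _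
    simpa using h1
  have hAP : (μHE[k] : Measure (Rn n)) A ≤ (c : ℝ≥0∞) ^ k * (μHE[k] : Measure T) (P '' A) := by
    have h1 := euclideanHausdorffMeasure_image_le k (f := id) (g := P) (A := A) (C := c)
      fun y hy z hz => by
        rw [dist_eq_norm, dist_eq_norm, ← map_sub]
        exact (happ y (hA hy) z (hA hz)).1
    simpa using h1
  have hLP : (μHE[k] : Measure (Rn n)) (h '' A) =
      ENNReal.ofReal L.normDet * (μHE[k] : Measure T) (P '' A) := by
    have h1 := L.euclideanHausdorffMeasure_image (P '' A)
    rw [hTk, image_image] at h1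
    rw [hhdef, h1]
  have hcC' : (c : ℝ≥0∞) ^ (2 * k) ≤ C := by exact_mod_cast hcC
  have hc1 : (1 : ℝ≥0∞) ≤ c := by exact_mod_cast hc.le
  constructor
  · calc (μHE[k] : Measure (Rn n)) (f '' A) ≤ (c : ℝ≥0∞) ^ k *
          (ENNReal.ofReal L.normDet * (μHE[k] : Measure T) (P '' A)) := hLP ▸ hfh
      _ ≤ C * (ENNReal.ofReal L.normDet * (μHE[k] : Measure (Rn n)) A) := by
        gcongr
        exact (pow_le_pow_right₀ hc1 (by omega)).trans hcC'
  · calc ENNReal.ofReal L.normDet * (μHE[k] : Measure (Rn n)) A ≤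
          ENNReal.ofReal L.normDet * ((c : ℝ≥0∞) ^ k * (μHE[k] : Measure T) (P '' A)) := by gcongr
      _ = (c : ℝ≥0∞) ^ k * (μHE[k] : Measure (Rn n)) (h '' A) := by rw [hLP]; ring
      _ ≤ (c : ℝ≥0∞) ^ k * ((c : ℝ≥0∞) ^ k * (μHE[k] : Measure (Rn n)) (f '' A)) := by gcongr
      _ = (c : ℝ≥0∞) ^ (2 * k) * (μHE[k] : Measure (Rn n)) (f '' A) := by ring
      _ ≤ C * (μHE[k] : Measure (Rn n)) (f '' A) := by gcongr

end AreaFormula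

/-! ### The area formula on oriented rectifiable sets. -/

section AreaFormulaGlobal

open Filter
open scoped Topology NNReal

/-- The Jacobian of `φ` along an oriented set with orientation `τ`. -/
noncomputable def jacobian {n k : ℕ} (φ : Rn n → Rn n) (τ : Rn n → Vec n k) (x : Rn n) : ℝ :=
  mass (wedgeMap (fderiv ℝ φ x) (τ x))

theorem continuousOn_wedgeMap_fderiv {n k : ℕ} {φ : OpenPartialHomeomorph (Rn n) (Rn n)}
    (h : ContDiffOn ℝ 1 φ φ.source) {P : Set (Rn n)} (hP : P ⊆ φ.source) {τ : Rn n → Vec n k}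
    (hτ : ContinuousOn τ P) : ContinuousOn (fun x => wedgeMap (fderiv ℝ φ x) (τ x)) P := by
  have h1 : ContinuousOn (fderiv ℝ φ) P :=
    (h.continuousOn_fderiv_of_isOpen φ.open_source le_rfl).mono hP
  have h2 := (ContinuousAlternatingMap.continuous_compContinuousLinearMapCLM
    (𝕜 := ℝ) (ι := Fin k) (E := Rn n) (F := Rn n) (G := ℝ)).comp_continuousOn h1
  exact hτ.clm_comp h2

theorem continuousOn_jacobian {n k : ℕ} {φ : OpenPartialHomeomorph (Rn n) (Rn n)}
    (h : ContDiffOn ℝ 1 φ φ.source) {P : Set (Rn n)} (hP : P ⊆ φ.source) {τ : Rn n → Vec n k}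
    (hτ : ContinuousOn τ P) : ContinuousOn (jacobian φ τ) P :=
  continuous_mass.comp_continuousOn (continuousOn_wedgeMap_fderiv h hP hτ)

theorem le_of_forall_le_nnreal_sq_mul {a b : ℝ≥0∞}
    (h : ∀ C : ℝ≥0, 1 < C → a ≤ (C : ℝ≥0∞) ^ 2 * b) : a ≤ b := by
  have h1 : Tendsto (fun C : ℝ≥0 => ((C : ℝ≥0∞) ^ 2) * b) (𝓝[>] 1) (𝓝 (1 * b)) := by
    refine ENNReal.Tendsto.mul_const ?_ (Or.inl one_ne_zero)
    have h2 : Tendsto (fun C : ℝ≥0 => (C : ℝ≥0∞) ^ 2) (𝓝 1) (𝓝 (((1 : ℝ≥0) : ℝ≥0∞) ^ 2)) :=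
      ((ENNReal.continuous_pow 2).comp ENNReal.continuous_coe).tendsto 1
    rw [ENNReal.coe_one, one_pow] at h2
    exact h2.mono_left nhdsWithin_le_nhds
  rw [one_mul] at h1
  refine ge_of_tendsto h1 ?_
  filter_upwards [self_mem_nhdsWithin] with C hC using h C hC

theorem measure_image_le_of_lipschitzOnWith {n k : ℕ} {φ : Rn n → Rn n} {K s : Set (Rn n)}
    {C : ℝ≥0} (hC : LipschitzOnWith C φ K) (hs : s ⊆ K) :
    (μHE[k] : Measure (Rn n)) (φ '' s) ≤ (C : ℝ≥0∞) ^ k * (μHE[k] : Measure (Rn n)) s := by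
  have h1 := euclideanHausdorffMeasure_image_le k (f := φ) (g := id) (C := C)
    (A := s) fun x hx y hy => hC.dist_le_mul x (hs hx) y (hs hy)
  rwa [image_id] at h1

/-- Compactness provides one Lipschitz constant on `K`. This is what lets exceptional null sets be
carried through `φ` and its inverse. -/
theorem measure_image_eq_zero {n k : ℕ} {φ : OpenPartialHomeomorph (Rn n) (Rn n)}
    (h : ContDiffOn ℝ 1 φ φ.source) {K s : Set (Rn n)} (hK : IsCompact K) (hKs : K ⊆ φ.source)
    (hs : s ⊆ K) (h0 : (μHE[k] : Measure (Rn n)) s = 0) :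
    (μHE[k] : Measure (Rn n)) (φ '' s) = 0 := by
  obtain ⟨C, hC⟩ := exists_lipschitzOnWith_of_isCompact h hK hKs
  have h1 := measure_image_le_of_lipschitzOnWith (k := k) hC hs
  rw [h0, mul_zero] at h1
  exact le_antisymm h1 zero_le

/-- Area formula up to a factor close to one, near a point of a piece `P` of a submanifold. -/
theorem exists_nhds_measure_image_le_lintegral {n k : ℕ}
    {φ : OpenPartialHomeomorph (Rn n) (Rn n)} (h : ContDiffOn ℝ 1 φ φ.source)
    (h' : ContDiffOn ℝ 1 φ.symm φ.target) {M P : Set (Rn n)} (hM : IsC1Submanifold k M)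
    (hPM : P ⊆ M) (hPs : P ⊆ φ.source) {τ : Rn n → Vec n k} (hτ : ContinuousOn τ P)
    (hτT : ∀ x ∈ P, IsUnitSimple (τ x) (tangentConeAt ℝ M x)) {C : ℝ≥0} (hC : 1 < C)
    {x : Rn n} (hx : x ∈ P) :
    ∃ U : Set (Rn n), IsOpen U ∧ x ∈ U ∧ ∀ B ⊆ P ∩ U, MeasurableSet B →
      (μHE[k] : Measure (Rn n)) (φ '' B) ≤
        (C : ℝ≥0∞) ^ 2 * ∫⁻ y in B, ENNReal.ofReal (jacobian φ τ y) ∂(μHE[k]) ∧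
      ∫⁻ y in B, ENNReal.ofReal (jacobian φ τ y) ∂(μHE[k]) ≤
        (C : ℝ≥0∞) ^ 2 * (μHE[k] : Measure (Rn n)) (φ '' B) := by
  obtain ⟨T, hT, hTk⟩ := (hτT x hx).exists_submodule
  have hinj := fderiv_injective h h' (hPs hx)
  obtain ⟨U, hU, hUA⟩ := hM.exists_nhds_measure_image (hPM hx) hT hTk
    (hasStrictFDerivAt_of_contDiffOn h (hPs hx)) hinj hC
  have hJ : ((fderiv ℝ φ x : Rn n →ₗ[ℝ] Rn n).domRestrict T).normDet = jacobian φ τ x :=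
    IsUnitSimple.normDet_eq (hT ▸ hτT x hx) hinj
  rw [hJ] at hUA
  have hJ0 : 0 < jacobian φ τ x := (hτT x hx).wedgeMap_mass_pos hinj
  have hC' : (1 : ℝ) < C := by exact_mod_cast hC
  have hC0 : (0 : ℝ) < C := zero_lt_one.trans hC'
  have hcont : Tendsto (jacobian φ τ) (𝓝[P] x) (𝓝 (jacobian φ τ x)) :=
    continuousOn_jacobian h hPs hτ x hx
  -- Freezing the Jacobian at `x` costs the second factor `C`; the first comes from the local
  -- measure estimate.
  have e1 : ∀ᶠ y in 𝓝[P] x, jacobian φ τ y < C * jacobian φ τ x :=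
    hcont.eventually_lt_const (by nlinarith)
  have e2 : ∀ᶠ y in 𝓝[P] x, jacobian φ τ x < C * jacobian φ τ y :=
    (hcont.const_mul (C : ℝ)).eventually_const_lt (by nlinarith)
  obtain ⟨V, hV, hVP⟩ := mem_nhdsWithin_iff_exists_mem_nhds_inter.1 (e1.and e2)
  refine ⟨interior (U ∩ V), isOpen_interior, mem_interior_iff_mem_nhds.2 (inter_mem hU hV),
    fun B hB hBm => ?_⟩
  have hBU : ∀ y ∈ B, y ∈ U ∧ y ∈ V := fun y hy =>
    interior_subset (s := U ∩ V) (hB hy).2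
  obtain ⟨i1, i2⟩ := hUA B fun y hy => ⟨hPM (hB hy).1, (hBU y hy).1⟩
  have hconst : ∫⁻ _ in B, ENNReal.ofReal (jacobian φ τ x) ∂(μHE[k] : Measure (Rn n)) =
      ENNReal.ofReal (jacobian φ τ x) * (μHE[k] : Measure (Rn n)) B := setLIntegral_const _ _
  have hofReal : ∀ r : ℝ, ENNReal.ofReal (C * r) = C * ENNReal.ofReal r := fun r => by
    rw [ENNReal.ofReal_mul hC0.le, ENNReal.ofReal_coe_nnreal]
  have j1 : ∫⁻ _ in B, ENNReal.ofReal (jacobian φ τ x) ∂(μHE[k] : Measure (Rn n)) ≤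
      C * ∫⁻ y in B, ENNReal.ofReal (jacobian φ τ y) ∂(μHE[k]) := by
    rw [← lintegral_const_mul' _ _ ENNReal.coe_ne_top]
    refine setLIntegral_mono' hBm fun y hy => ?_
    rw [← hofReal]
    exact ENNReal.ofReal_le_ofReal (hVP ⟨(hBU y hy).2, (hB hy).1⟩).2.le
  have j2 : ∫⁻ y in B, ENNReal.ofReal (jacobian φ τ y) ∂(μHE[k]) ≤
      C * ∫⁻ _ in B, ENNReal.ofReal (jacobian φ τ x) ∂(μHE[k] : Measure (Rn n)) := by
    rw [← lintegral_const_mul' _ _ ENNReal.coe_ne_top]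
    refine setLIntegral_mono' hBm fun y hy => ?_
    rw [← hofReal]
    exact ENNReal.ofReal_le_ofReal (hVP ⟨(hBU y hy).2, (hB hy).1⟩).1.le
  rw [hconst] at j1 j2
  constructor
  · rw [sq, mul_assoc]
    exact i1.trans (by gcongr)
  · rw [sq, mul_assoc]
    exact j2.trans (by gcongr)

theorem measure_image_iUnion_of_injOn {n k : ℕ} {φ : OpenPartialHomeomorph (Rn n) (Rn n)}
    {B : ℕ → Set (Rn n)} (hB : ∀ i, MeasurableSet (B i)) (hBs : ∀ i, B i ⊆ φ.source)
    (hd : Pairwise fun i j => Disjoint (B i) (B j)) :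
    (μHE[k] : Measure (Rn n)) (φ '' ⋃ i, B i) = ∑' i, (μHE[k] : Measure (Rn n)) (φ '' B i) := by
  rw [image_iUnion]
  refine measure_iUnion (fun i j hij => ?_) fun i =>
    (hB i).image_of_continuousOn_injOn (φ.continuousOn.mono (hBs i)) (φ.injOn.mono (hBs i))
  refine disjoint_left.2 ?_
  rintro _ ⟨x, hx, rfl⟩ ⟨y, hy, hxy⟩
  rw [φ.injOn (hBs j hy) (hBs i hx) hxy] at hy
  exact disjoint_left.1 (hd hij) hx hy

/-- Area formula on a measurable piece of a submanifold. -/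
theorem measure_image_piece_eq_lintegral {n k : ℕ}
    {φ : OpenPartialHomeomorph (Rn n) (Rn n)} (h : ContDiffOn ℝ 1 φ φ.source)
    (h' : ContDiffOn ℝ 1 φ.symm φ.target) {M P : Set (Rn n)} (hM : IsC1Submanifold k M)
    (hPM : P ⊆ M) (hPs : P ⊆ φ.source) (hPm : MeasurableSet P) {τ : Rn n → Vec n k}
    (hτ : ContinuousOn τ P) (hτT : ∀ x ∈ P, IsUnitSimple (τ x) (tangentConeAt ℝ M x)) :
    (μHE[k] : Measure (Rn n)) (φ '' P) =
      ∫⁻ y in P, ENNReal.ofReal (jacobian φ τ y) ∂(μHE[k]) := by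
  rcases P.eq_empty_or_nonempty with rfl | hne
  · simp
  have key : ∀ C : ℝ≥0, 1 < C →
      (μHE[k] : Measure (Rn n)) (φ '' P) ≤
        (C : ℝ≥0∞) ^ 2 * ∫⁻ y in P, ENNReal.ofReal (jacobian φ τ y) ∂(μHE[k]) ∧
      ∫⁻ y in P, ENNReal.ofReal (jacobian φ τ y) ∂(μHE[k]) ≤
        (C : ℝ≥0∞) ^ 2 * (μHE[k] : Measure (Rn n)) (φ '' P) := by
    intro C hC
    have hloc := fun x (hx : x ∈ P) =>
      exists_nhds_measure_image_le_lintegral h h' hM hPM hPs hτ hτT hC hx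
    choose! U hUo hxU hUB using hloc
    -- Countably many of the neighbourhoods cover `P` (Lindelöf); made disjoint, they cut `P` into
    -- Borel parts on which the estimates add up with the same `C`.
    obtain ⟨t, htP, htc, hcov⟩ := countable_cover_nhdsWithin (f := U) (s := P)
      fun x hx => mem_nhdsWithin_of_mem_nhds ((hUo x hx).mem_nhds (hxU x hx))
    have htne : t.Nonempty := by
      obtain ⟨x, hx⟩ := hne
      obtain ⟨y, hy, -⟩ := mem_iUnion₂.1 (hcov hx)
      exact ⟨y, hy⟩
    obtain ⟨u, rfl⟩ := htc.exists_eq_range htne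
    have hu : ∀ i, u i ∈ P := fun i => htP ⟨i, rfl⟩
    set B : ℕ → Set (Rn n) := fun i => P ∩ disjointed (fun i => U (u i)) i
    have hBm : ∀ i, MeasurableSet (B i) := fun i =>
      hPm.inter (MeasurableSet.disjointed (fun j => (hUo _ (hu j)).measurableSet) i)
    have hBd : Pairwise fun i j => Disjoint (B i) (B j) := fun i j hij =>
      (disjoint_disjointed (fun i => U (u i)) hij).mono inter_subset_right inter_subset_right
    have hPB : P = ⋃ i, B i := by
      rw [← inter_iUnion, iUnion_disjointed, eq_comm, inter_eq_left]
      intro x hx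
      simpa using hcov hx
    have hBU : ∀ i, B i ⊆ P ∩ U (u i) := fun i =>
      inter_subset_inter_right _ (disjointed_subset _ i)
    have e1 : (μHE[k] : Measure (Rn n)) (φ '' P) = ∑' i, (μHE[k] : Measure (Rn n)) (φ '' B i) := by
      rw [hPB]
      exact measure_image_iUnion_of_injOn hBm (fun i => inter_subset_left.trans hPs) hBd
    have e2 : ∫⁻ y in P, ENNReal.ofReal (jacobian φ τ y) ∂(μHE[k]) =
        ∑' i, ∫⁻ y in B i, ENNReal.ofReal (jacobian φ τ y) ∂(μHE[k] : Measure (Rn n)) := by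
      rw [hPB]
      exact lintegral_iUnion hBm hBd _
    rw [e1, e2, ← ENNReal.tsum_mul_left, ← ENNReal.tsum_mul_left]
    exact ⟨ENNReal.tsum_le_tsum fun i => (hUB _ (hu i) (B i) (hBU i) (hBm i)).1,
      ENNReal.tsum_le_tsum fun i => (hUB _ (hu i) (B i) (hBU i) (hBm i)).2⟩
  exact le_antisymm (le_of_forall_le_nnreal_sq_mul fun C hC => (key C hC).1)
    (le_of_forall_le_nnreal_sq_mul fun C hC => (key C hC).2)

namespace OrientedRectifiable

variable {n k : ℕ} (R : OrientedRectifiable n k)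

theorem isUnitSimple_of_mem_reg {x : Rn n} (hx : x ∈ R.reg) :
    ∃ W, IsUnitSimple (R.orientation x) W := by
  rw [R.reg_eq] at hx
  obtain ⟨i, hi⟩ := mem_iUnion.1 hx
  exact ⟨_, R.orientation_tangent i x hi⟩

/-- A Borel subset of the regular part, of full measure, made of Borel subsets of the pieces. -/
theorem exists_measurable_core : ∃ A : ℕ → Set (Rn n), (∀ i, MeasurableSet (A i)) ∧
    (∀ i, A i ⊆ R.piece i) ∧ (μHE[k] : Measure (Rn n)) (R.carrier \ ⋃ i, A i) = 0 := by
  choose A hAP hAm hAe using fun i => (R.piece_measurable i).exists_measurable_subset_ae_eq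
  refine ⟨A, hAm, hAP, measure_mono_null (t := (R.carrier \ R.reg) ∪ ⋃ i, R.piece i \ A i) ?_ ?_⟩
  · rintro x ⟨hx, hxA⟩
    by_cases hr : x ∈ R.reg
    · rw [R.reg_eq] at hr
      obtain ⟨i, hi⟩ := mem_iUnion.1 hr
      exact Or.inr (mem_iUnion.2 ⟨i, hi, fun h => hxA (mem_iUnion.2 ⟨i, h⟩)⟩)
    · exact Or.inl ⟨hx, hr⟩
  · exact measure_union_null R.sing_null
      (measure_iUnion_null fun i => (ae_eq_set.1 (hAe i)).2)

variable {φ : OpenPartialHomeomorph (Rn n) (Rn n)}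

/-- The area formula: on a Borel set of full measure in `R` the map `φ` transports the measure
`J dℋ^k`, where `J` is the Jacobian of `φ` along `R`, to `ℋ^k`. -/
theorem exists_map_withDensity_eq (h : ContDiffOn ℝ 1 φ φ.source)
    (h' : ContDiffOn ℝ 1 φ.symm φ.target) {K : Set (Rn n)} (hK : IsCompact K)
    (hKs : K ⊆ φ.source) (hRK : R.carrier ⊆ K) :
    ∃ (A : Set (Rn n)) (f : Rn n → Rn n), MeasurableSet A ∧ A ⊆ R.reg ∧
      (μHE[k] : Measure (Rn n)).restrict A = (μHE[k] : Measure (Rn n)).restrict R.carrier ∧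
      (μHE[k] : Measure (Rn n)).restrict (φ '' A) =
        (μHE[k] : Measure (Rn n)).restrict (φ '' R.carrier) ∧
      Measurable f ∧ EqOn f φ K ∧
      Measure.map f (((μHE[k] : Measure (Rn n)).restrict A).withDensity
        fun x => ENNReal.ofReal (jacobian φ R.orientation x)) =
        (μHE[k] : Measure (Rn n)).restrict (φ '' A) := by
  classical
  obtain ⟨A, hAm, hAP, hA0⟩ := R.exists_measurable_core
  have hAreg : (⋃ i, A i) ⊆ R.reg := by
    rw [R.reg_eq]; exact iUnion_mono hAP
  have hAc : (⋃ i, A i) ⊆ R.carrier := hAreg.trans R.reg_subset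
  have hAum : MeasurableSet (⋃ i, A i) := MeasurableSet.iUnion hAm
  have hAd : Pairwise fun i j => Disjoint (A i) (A j) := fun i j hij =>
    (R.piece_disjoint hij).mono (hAP i) (hAP j)
  have hAis : ∀ i, A i ⊆ φ.source := fun i =>
    (subset_iUnion A i).trans (hAc.trans (hRK.trans hKs))
  -- Only its values on `K` matter, so `φ` is replaced by a globally measurable map, zero off `K`,
  -- which can push measures forward.
  have hcont : ContinuousOn φ K := φ.continuousOn.mono hKs
  set f : Rn n → Rn n := K.piecewise φ fun _ => 0
  have hf : Measurable f :=
    hcont.measurable_piecewise continuousOn_const hK.measurableSet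
  have hfK : EqOn f φ K := piecewise_eqOn _ _ _
  refine ⟨⋃ i, A i, f, hAum, hAreg, ?_, ?_, hf, hfK, ?_⟩
  · exact Measure.restrict_congr_set
      (ae_eq_set.2 ⟨by rw [sdiff_eq_empty.2 hAc]; simp, hA0⟩)
  · refine Measure.restrict_congr_set (ae_eq_set.2 ⟨?_, ?_⟩)
    · rw [sdiff_eq_empty.2 (image_mono hAc)]; simp
    · refine measure_mono_null (t := φ '' (R.carrier \ ⋃ i, A i)) ?_ ?_
      · rintro _ ⟨⟨x, hx, rfl⟩, hxA⟩
        exact ⟨x, ⟨hx, fun hx' => hxA ⟨x, hx', rfl⟩⟩, rfl⟩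
      exact measure_image_eq_zero h hK hKs (sdiff_subset.trans hRK) hA0
  · ext B hB
    rw [Measure.map_apply hf hB, withDensity_apply _ (hf hB), Measure.restrict_apply hB,
      Measure.restrict_restrict (hf hB)]
    have e1 : B ∩ φ '' (⋃ i, A i) = φ '' (⋃ i, f ⁻¹' B ∩ A i) := by
      rw [← inter_iUnion]
      ext y
      constructor
      · rintro ⟨hyB, x, hx, rfl⟩
        refine ⟨x, ⟨?_, hx⟩, rfl⟩
        change f x ∈ B
        rwa [hfK (hRK (hAc hx))]
      · rintro ⟨x, ⟨hxB, hx⟩, rfl⟩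
        refine ⟨?_, x, hx, rfl⟩
        rw [← hfK (hRK (hAc hx))]
        exact hxB
    have hBm : ∀ i, MeasurableSet (f ⁻¹' B ∩ A i) := fun i => (hf hB).inter (hAm i)
    have hBd : Pairwise fun i j => Disjoint (f ⁻¹' B ∩ A i) (f ⁻¹' B ∩ A j) := fun i j hij =>
      (hAd hij).mono inter_subset_right inter_subset_right
    rw [e1, inter_iUnion, lintegral_iUnion hBm hBd,
      measure_image_iUnion_of_injOn hBm (fun i => inter_subset_right.trans (hAis i)) hBd]
    refine tsum_congr fun i => Eq.symm ?_
    exact measure_image_piece_eq_lintegral h h' (R.isSubmanifold i)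
      (inter_subset_right.trans ((hAP i).trans (R.piece_subset i)))
      (inter_subset_right.trans (hAis i)) (hBm i)
      (R.orientation_continuousOn.mono
        (inter_subset_right.trans ((subset_iUnion A i).trans hAreg)))
      fun x hx => R.orientation_tangent i x (hAP i hx.2)

theorem measure_image_eq_lintegral (h : ContDiffOn ℝ 1 φ φ.source)
    (h' : ContDiffOn ℝ 1 φ.symm φ.target) {K : Set (Rn n)} (hK : IsCompact K)
    (hKs : K ⊆ φ.source) (hRK : R.carrier ⊆ K) :
    (μHE[k] : Measure (Rn n)) (φ '' R.carrier) =
      ∫⁻ x in R.carrier, ENNReal.ofReal (jacobian φ R.orientation x) ∂(μHE[k]) := by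
  obtain ⟨A, f, hAm, hAreg, hA1, hA2, hf, hfK, hmap⟩ :=
    R.exists_map_withDensity_eq h h' hK hKs hRK
  have h1 := congrArg (fun μ : Measure (Rn n) => μ univ) hmap
  simp only [Measure.map_apply hf MeasurableSet.univ, preimage_univ] at h1
  rw [withDensity_apply _ MeasurableSet.univ, Measure.restrict_univ, hA1, hA2,
    Measure.restrict_apply_univ] at h1
  exact h1.symm

theorem aemeasurable_jacobian (h : ContDiffOn ℝ 1 φ φ.source) (hR : R.carrier ⊆ φ.source) :
    AEMeasurable (jacobian φ R.orientation) ((μHE[k] : Measure (Rn n)).restrict R.carrier) := by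
  obtain ⟨A, hAm, hAP, hA0⟩ := R.exists_measurable_core
  have hAreg : (⋃ i, A i) ⊆ R.reg := by
    rw [R.reg_eq]; exact iUnion_mono hAP
  have hAc : (⋃ i, A i) ⊆ R.carrier := hAreg.trans R.reg_subset
  have h1 : (μHE[k] : Measure (Rn n)).restrict (⋃ i, A i) =
      (μHE[k] : Measure (Rn n)).restrict R.carrier :=
    Measure.restrict_congr_set (ae_eq_set.2 ⟨by rw [sdiff_eq_empty.2 hAc]; simp, hA0⟩)
  rw [← h1]
  exact (continuousOn_jacobian h (hAc.trans hR)
    (R.orientation_continuousOn.mono hAreg)).aemeasurable (MeasurableSet.iUnion hAm)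

theorem setIntegral_image_eq (h : ContDiffOn ℝ 1 φ φ.source)
    (h' : ContDiffOn ℝ 1 φ.symm φ.target) {K : Set (Rn n)} (hK : IsCompact K)
    (hKs : K ⊆ φ.source) (hRK : R.carrier ⊆ K) {g : Rn n → ℝ}
    (hg : AEStronglyMeasurable g ((μHE[k] : Measure (Rn n)).restrict (φ '' R.carrier))) :
    ∫ y in φ '' R.carrier, g y ∂(μHE[k] : Measure (Rn n)) =
      ∫ x in R.carrier, jacobian φ R.orientation x * g (φ x) ∂(μHE[k] : Measure (Rn n)) := by
  obtain ⟨A, f, hAm, hAreg, hA1, hA2, hf, hfK, hmap⟩ :=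
    R.exists_map_withDensity_eq h h' hK hKs hRK
  have hAK : A ⊆ K := hAreg.trans (R.reg_subset.trans hRK)
  rw [← hA2, ← hmap] at hg
  rw [← hA1, ← hA2, ← hmap, integral_map hf.aemeasurable hg]
  have hJ : AEMeasurable (fun x => (jacobian φ R.orientation x).toNNReal)
      ((μHE[k] : Measure (Rn n)).restrict A) := by
    rw [hA1]
    exact (R.aemeasurable_jacobian h (hRK.trans hKs)).real_toNNReal
  have h1 := integral_withDensity_eq_integral_smul₀ hJ fun x => g (f x)
  refine h1.trans (setIntegral_congr_fun hAm fun x hx => ?_)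
  simp only [NNReal.smul_def, smul_eq_mul]
  have hJ0 : 0 ≤ jacobian φ R.orientation x := mass_nonneg _
  rw [Real.coe_toNNReal _ hJ0, hfK (hAK hx)]

end OrientedRectifiable

end AreaFormulaGlobal

/-! ### Images of oriented rectifiable sets under `C¹` diffeomorphisms. -/

section Image

open Filter
open scoped Topology NNReal

variable {n k : ℕ} {φ : OpenPartialHomeomorph (Rn n) (Rn n)}

/-- A Borel subset of full measure has Borel image, because `φ` is continuous and injective on it;
what remains has null image. -/
theorem nullMeasurableSet_image (h : ContDiffOn ℝ 1 φ φ.source) {K s : Set (Rn n)}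
    (hK : IsCompact K) (hKs : K ⊆ φ.source) (hs : s ⊆ K)
    (hsm : NullMeasurableSet s (μHE[k] : Measure (Rn n))) :
    NullMeasurableSet (φ '' s) (μHE[k] : Measure (Rn n)) := by
  obtain ⟨t, hts, htm, hte⟩ := hsm.exists_measurable_subset_ae_eq
  have htK := hts.trans (hs.trans hKs)
  have h1 : MeasurableSet (φ '' t) :=
    htm.image_of_continuousOn_injOn (φ.continuousOn.mono htK) (φ.injOn.mono htK)
  have h2 : (μHE[k] : Measure (Rn n)) (φ '' (s \ t)) = 0 :=
    measure_image_eq_zero h hK hKs (sdiff_subset.trans hs) (ae_eq_set.1 hte).2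
  have h3 : φ '' s = φ '' t ∪ φ '' (s \ t) := by
    rw [← image_union, union_sdiff_cancel hts]
  rw [h3]
  exact h1.nullMeasurableSet.union (NullMeasurableSet.of_null h2)

theorem IsC1Submanifold.image (h : ContDiffOn ℝ 1 φ φ.source)
    (h' : ContDiffOn ℝ 1 φ.symm φ.target) {M : Set (Rn n)} (hM : IsC1Submanifold k M) :
    IsC1Submanifold k (φ '' (M ∩ φ.source)) := by
  rintro _ ⟨x, ⟨hxM, hxs⟩, rfl⟩
  obtain ⟨Φ, W, hxΦ, hΦ, hΦ', hW, hMW⟩ := hM x hxM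
  refine ⟨φ.symm.trans Φ, W, ?_, ?_, ?_, hW, ?_⟩
  · rw [OpenPartialHomeomorph.trans_source]
    exact ⟨φ.map_source hxs, by simpa [φ.left_inv hxs] using hxΦ⟩
  · rw [OpenPartialHomeomorph.trans_source, OpenPartialHomeomorph.coe_trans]
    exact hΦ.comp (h'.mono inter_subset_left) fun y hy => hy.2
  · rw [OpenPartialHomeomorph.trans_target, OpenPartialHomeomorph.coe_trans_symm]
    exact h.comp (hΦ'.mono inter_subset_left) fun y hy => hy.2
  · intro y hy
    rw [OpenPartialHomeomorph.trans_source] at hy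
    have hyt : y ∈ φ.target := hy.1
    rw [OpenPartialHomeomorph.coe_trans, Function.comp_apply, ← hMW _ hy.2]
    constructor
    · rintro ⟨z, ⟨hzM, hzs⟩, rfl⟩
      rwa [φ.left_inv hzs]
    · intro hyM
      exact ⟨φ.symm y, ⟨hyM, φ.map_target hyt⟩, φ.right_inv hyt⟩

theorem tangentConeAt_image (h : ContDiffOn ℝ 1 φ φ.source)
    (h' : ContDiffOn ℝ 1 φ.symm φ.target) {M : Set (Rn n)} {x : Rn n} (hx : x ∈ φ.source) :
    tangentConeAt ℝ (φ '' (M ∩ φ.source)) (φ x) = fderiv ℝ φ x '' tangentConeAt ℝ M x := by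
  have h1 := (hasStrictFDerivAt_of_contDiffOn h hx).hasFDerivAt
  have h2 := (hasStrictFDerivAt_of_contDiffOn (φ := φ.symm) h' (φ.map_source hx)).hasFDerivAt
  have hM : tangentConeAt ℝ (M ∩ φ.source) x = tangentConeAt ℝ M x :=
    tangentConeAt_inter_nhds (φ.open_source.mem_nhds hx)
  have hinv : φ.symm '' (φ '' (M ∩ φ.source)) = M ∩ φ.source :=
    φ.toPartialEquiv.symm_image_image_of_subset_source inter_subset_right
  refine Subset.antisymm ?_ ?_
  · intro w hw
    have h3 := (h2.hasFDerivWithinAt (s := φ '' (M ∩ φ.source))).mapsTo_tangent_cone hw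
    rw [hinv, φ.left_inv hx, hM] at h3
    refine ⟨_, h3, ?_⟩
    have h4 := fderiv_symm_comp_fderiv (φ := φ.symm) h' h (φ.map_source hx)
    rw [φ.symm_symm, φ.left_inv hx] at h4
    exact DFunLike.congr_fun h4 w
  · rintro _ ⟨v, hv, rfl⟩
    rw [← hM] at hv
    exact (h1.hasFDerivWithinAt (s := M ∩ φ.source)).mapsTo_tangent_cone hv

/-- Since `φ` is known to be Lipschitz only on `K`, each `φ ∘ f i` is restricted to the preimage of
`K` and then extended to a Lipschitz map on all of `ℝ^k`. -/
theorem IsRectifiable.image {S K : Set (Rn n)} (hS : IsRectifiable k S)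
    (h : ContDiffOn ℝ 1 φ φ.source) (hK : IsCompact K) (hKs : K ⊆ φ.source) (hSK : S ⊆ K) :
    IsRectifiable k (φ '' S) := by
  obtain ⟨f, hf, h0⟩ := hS
  obtain ⟨C, hC⟩ := exists_lipschitzOnWith_of_isCompact h hK hKs
  have hext : ∀ i, ∃ g : Rn k → Rn n, (∃ L, LipschitzWith L g) ∧ EqOn (φ ∘ f i) g (f i ⁻¹' K) := by
    intro i
    obtain ⟨L, hL⟩ := hf i
    have h1 : LipschitzOnWith (C * L) (φ ∘ f i) (f i ⁻¹' K) :=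
      hC.comp (hL.lipschitzOnWith (s := f i ⁻¹' K)) fun x hx => hx
    obtain ⟨g, hg, hgE⟩ := h1.extend_finite_dimension
    exact ⟨g, ⟨_, hg⟩, hgE⟩
  choose g hg hgE using hext
  refine ⟨g, hg, measure_mono_null (t := φ '' (S \ ⋃ i, range (f i))) ?_
    (measure_image_eq_zero h hK hKs (sdiff_subset.trans hSK) h0)⟩
  rintro _ ⟨⟨x, hx, rfl⟩, hxg⟩
  refine ⟨x, ⟨hx, fun hxf => hxg ?_⟩, rfl⟩
  obtain ⟨i, u, rfl⟩ := mem_iUnion.1 hxf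
  exact mem_iUnion.2 ⟨i, u, (hgE i (hSK hx)).symm⟩

/-- The image of an oriented rectifiable set under a `C¹` diffeomorphism, with the inherited
orientation. -/
noncomputable def OrientedRectifiable.image (R : OrientedRectifiable n k)
    (h : ContDiffOn ℝ 1 φ φ.source) (h' : ContDiffOn ℝ 1 φ.symm φ.target) {K : Set (Rn n)}
    (hK : IsCompact K) (hKs : K ⊆ φ.source) (hRK : R.carrier ⊆ K) : OrientedRectifiable n k where
  carrier := φ '' R.carrier
  measurable := nullMeasurableSet_image h hK hKs hRK R.measurable
  finite := by
    obtain ⟨C, hC⟩ := exists_lipschitzOnWith_of_isCompact h hK hKs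
    exact (measure_image_le_of_lipschitzOnWith hC hRK).trans_lt
      (ENNReal.mul_lt_top (ENNReal.pow_lt_top ENNReal.coe_lt_top) R.finite)
  pos := by
    -- If the image were null, the inverse diffeomorphism would carry it back to a null set, namely
    -- `R.carrier`.
    refine pos_iff_ne_zero.2 fun h0 => R.pos.ne' ?_
    have hKt : φ '' K ⊆ φ.symm.source := by
      rintro _ ⟨x, hx, rfl⟩
      exact φ.map_source (hKs hx)
    have h1 := measure_image_eq_zero (φ := φ.symm) h' (hK.image_of_continuousOn
      (φ.continuousOn.mono hKs)) hKt (image_mono hRK) h0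
    have h2 : φ.symm '' (φ '' R.carrier) = R.carrier :=
      φ.toPartialEquiv.symm_image_image_of_subset_source (hRK.trans hKs)
    rwa [h2] at h1
  rectifiable := R.rectifiable.image h hK hKs hRK
  reg := φ '' R.reg
  reg_subset := image_mono R.reg_subset
  sing_null := by
    rw [← (φ.injOn.mono (hRK.trans hKs)).image_sdiff_subset R.reg_subset]
    exact measure_image_eq_zero h hK hKs (sdiff_subset.trans hRK) R.sing_null
  piece i := φ '' R.piece i
  manifold i := φ '' (R.manifold i ∩ φ.source)
  reg_eq := by rw [R.reg_eq, image_iUnion]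
  piece_disjoint i j hij := by
    have hs : ∀ i, R.piece i ⊆ φ.source := fun i =>
      (subset_iUnion R.piece i).trans (R.reg_eq ▸ R.reg_subset.trans (hRK.trans hKs))
    refine disjoint_left.2 ?_
    rintro _ ⟨x, hx, rfl⟩ ⟨y, hy, hxy⟩
    rw [φ.injOn (hs j hy) (hs i hx) hxy] at hy
    exact disjoint_left.1 (R.piece_disjoint hij) hx hy
  piece_measurable i := nullMeasurableSet_image h hK hKs
    ((subset_iUnion R.piece i).trans (R.reg_eq ▸ R.reg_subset.trans hRK)) (R.piece_measurable i)
  piece_subset i := image_mono fun x hx => ⟨R.piece_subset i hx,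
    hKs (hRK (R.reg_subset (R.reg_eq ▸ mem_iUnion.2 ⟨i, hx⟩)))⟩
  isSubmanifold i := (R.isSubmanifold i).image h h'
  orientation y := (jacobian φ R.orientation (φ.symm y))⁻¹ •
    wedgeMap (fderiv ℝ φ (φ.symm y)) (R.orientation (φ.symm y))
  orientation_continuousOn := by
    have hrs : R.reg ⊆ φ.source := R.reg_subset.trans (hRK.trans hKs)
    have h1 : ContinuousOn (fun x => (jacobian φ R.orientation x)⁻¹ •
        wedgeMap (fderiv ℝ φ x) (R.orientation x)) R.reg := by
      refine ContinuousOn.smul (ContinuousOn.inv₀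
        (continuousOn_jacobian h hrs R.orientation_continuousOn) fun x hx => ?_)
        (continuousOn_wedgeMap_fderiv h hrs R.orientation_continuousOn)
      obtain ⟨W, hW⟩ := R.isUnitSimple_of_mem_reg hx
      exact (hW.wedgeMap_mass_pos (fderiv_injective h h' (hrs hx))).ne'
    refine h1.comp (φ.symm.continuousOn.mono ?_) ?_
    · rintro _ ⟨x, hx, rfl⟩
      exact φ.map_source (hrs hx)
    · rintro _ ⟨x, hx, rfl⟩
      rwa [φ.left_inv (hrs hx)]
  orientation_tangent := by
    rintro i _ ⟨x, hx, rfl⟩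
    have hxs : x ∈ φ.source := hKs (hRK (R.reg_subset (R.reg_eq ▸ mem_iUnion.2 ⟨i, hx⟩)))
    rw [φ.left_inv hxs, tangentConeAt_image h h' hxs]
    exact (R.orientation_tangent i x hx).map (fderiv_injective h h' hxs)

end Image

/-! ### Change of variables for integrals of forms and for measures. -/

section Transfer

open Filter

variable {n k : ℕ} {F E : Compacts (Rn n)} (φ : C1Diffeo F E)

theorem C1Diffeo.subset_target : (E : Set (Rn n)) ⊆ φ.toHomeo.target := by
  rw [← φ.image_eq]
  rintro _ ⟨x, hx, rfl⟩
  exact φ.toHomeo.map_source (φ.subset_source hx)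

theorem OrientedRectifiable.ae_mem_reg (R : OrientedRectifiable n k) :
    ∀ᵐ x ∂((μHE[k] : Measure (Rn n)).restrict R.carrier), x ∈ R.reg := by
  rw [ae_restrict_iff'₀ R.measurable, ae_iff]
  refine measure_mono_null ?_ R.sing_null
  intro x hx
  exact Classical.not_imp.1 hx

/-- Every oriented rectifiable subset of `E` is the oriented image of one of `F`. -/
theorem C1Diffeo.exists_isOrientedImage (S : OrientedRectifiable n k)
    (hS : S.carrier ⊆ E) :
    ∃ R : OrientedRectifiable n k, R.carrier ⊆ F ∧ IsOrientedImage φ R S := by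
  set ψ := φ.toHomeo.symm
  have hSt : S.carrier ⊆ ψ.source := hS.trans φ.subset_target
  set R := S.image (φ := ψ) φ.contDiffOn_symm φ.contDiffOn E.isCompact φ.subset_target hS with hR
  refine ⟨R, ?_, ?_, ?_⟩
  · rintro _ ⟨y, hy, rfl⟩
    have h1 := hS hy
    rw [← φ.image_eq] at h1
    obtain ⟨x, hx, rfl⟩ := h1
    rwa [φ.toHomeo.left_inv (φ.subset_source hx)]
  · exact (ψ.toPartialEquiv.symm_image_image_of_subset_source hSt).symm
  · filter_upwards [R.ae_mem_reg] with x hx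
    obtain ⟨y, hy, rfl⟩ := hx
    have hyt : y ∈ φ.toHomeo.target := hSt (S.reg_subset hy)
    have hφy : φ.toHomeo (ψ y) = y := φ.toHomeo.right_inv hyt
    obtain ⟨W, hW⟩ := S.isUnitSimple_of_mem_reg hy
    have hpos : 0 < jacobian ψ S.orientation y := hW.wedgeMap_mass_pos
      (fderiv_injective (φ := ψ) φ.contDiffOn_symm φ.contDiffOn hyt)
    refine ⟨jacobian ψ S.orientation y, hpos, ?_⟩
    have h1 : R.orientation (ψ y) = (jacobian ψ S.orientation y)⁻¹ •
        wedgeMap (fderiv ℝ ψ y) (S.orientation y) := by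
      change (jacobian ψ S.orientation (φ.toHomeo (ψ y)))⁻¹ •
        wedgeMap (fderiv ℝ ψ (φ.toHomeo (ψ y))) (S.orientation (φ.toHomeo (ψ y))) = _
      rw [hφy]
    have h2 : (φ.D (ψ y)).comp (fderiv ℝ ψ y) = ContinuousLinearMap.id ℝ (Rn n) :=
      fderiv_symm_comp_fderiv (φ := ψ) φ.contDiffOn_symm φ.contDiffOn hyt
    rw [h1, wedgeMap_smul, wedgeMap_wedgeMap, h2, wedgeMap_id, smul_smul,
      mul_inv_cancel₀ hpos.ne', one_smul, hφy]

variable {φ} {R S : OrientedRectifiable n k}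

/-- The Jacobian produced by the change of variables cancels the factor normalising the transported
orientation: both come from the mass of `(Λ_k Dφ) τ`. -/
theorem IsOrientedImage.integralForm_eq (hRS : IsOrientedImage φ R S) (hR : R.carrier ⊆ F)
    (ω : TestForm k E) : integralForm S ω = integralForm R (φ.pullback k ω) := by
  obtain ⟨hc, hae⟩ := hRS
  have hRs := hR.trans φ.subset_source
  have hint := (integrableOn_pairing S ω).aestronglyMeasurable
  rw [hc] at hint
  rw [integralForm, integralForm, hc, R.setIntegral_image_eq φ.contDiffOn φ.contDiffOn_symm
    F.isCompact φ.subset_source hR hint]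
  -- The orientation of `S` is known to have unit mass only on `S.reg`; the rest of `S` is null and
  -- so is its preimage under `φ`.
  have hSreg : ∀ᵐ x ∂((μHE[k] : Measure (Rn n)).restrict R.carrier), φ.toHomeo x ∈ S.reg := by
    rw [ae_restrict_iff'₀ R.measurable, ae_iff]
    have h1 : (μHE[k] : Measure (Rn n)) (φ.toHomeo.symm '' (S.carrier \ S.reg)) = 0 := by
      refine measure_image_eq_zero (φ := φ.toHomeo.symm) φ.contDiffOn_symm E.isCompact
        φ.subset_target ?_ S.sing_null
      rw [hc, ← φ.image_eq]
      exact sdiff_subset.trans (image_mono hR)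
    refine measure_mono_null ?_ h1
    intro x hx
    obtain ⟨hxR, hxS⟩ := Classical.not_imp.1 hx
    exact ⟨φ.toHomeo x, ⟨hc ▸ mem_image_of_mem _ hxR, hxS⟩, φ.toHomeo.left_inv (hRs hxR)⟩
  refine integral_congr_ae ?_
  filter_upwards [hae, hSreg, ae_restrict_mem₀ R.measurable] with x hx hxS hxR
  obtain ⟨c, hc0, hcx⟩ := hx
  obtain ⟨W, hW⟩ := S.isUnitSimple_of_mem_reg hxS
  -- Unit mass of the orientation of `S` determines the positive constant: `c` is the inverse
  -- Jacobian.
  have h1 : c * jacobian φ.toHomeo R.orientation x = 1 := by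
    rw [← hW.mass_eq_one, hcx, mass_smul, abs_of_pos hc0]
    rfl
  have hxF : x ∈ F := hR hxR
  have hxE : φ.toHomeo x ∈ E := φ.mem ⟨x, hxF⟩
  have h2 : pairing S ω (φ.toHomeo x) = c * pairing R (φ.pullback k ω) x := by
    simp only [pairing, hxF, hxE, dif_pos, hcx]
    rfl
  rw [h2, ← mul_assoc, mul_comm _ c, h1, one_mul]

/-- Index shift: `sigma` counts from one, `singularValues` from zero. -/
theorem prod_sigma_Icc (j : Rn n) : ∏ i ∈ Finset.Icc 1 k, φ.sigma i j =
    ∏ i ∈ Finset.range k, (φ.D j : Rn n →ₗ[ℝ] Rn n).singularValues i :=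
  Finset.prod_nbij' (fun i => i - 1) (fun i => i + 1) (by simp; omega) (by simp)
    (by simp; omega) (by simp) (fun _ _ => rfl)

theorem prod_sigma_inv_Icc (hk : k ≤ n) (x : Rn n) :
    ∏ j ∈ Finset.Icc (n - k + 1) n, (φ.sigma j x)⁻¹ =
      (∏ i ∈ Finset.range k, (φ.D x : Rn n →ₗ[ℝ] Rn n).singularValues (n - k + i))⁻¹ := by
  rw [Finset.prod_inv_distrib]
  congr 1
  refine Finset.prod_nbij' (fun i => i - (n - k + 1)) (fun i => n - k + 1 + i) (by simp; omega)
    (by simp; omega) (by simp only [Finset.mem_Icc]; omega) (by simp) ?_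
  intro i hi
  rw [Finset.mem_Icc] at hi
  rw [C1Diffeo.sigma]
  congr 1
  omega

theorem IsOrientedImage.measure_le (hRS : IsOrientedImage φ R S) (hR : R.carrier ⊆ F) :
    (μHE[k] : Measure (Rn n)) S.carrier ≤
      supNorm F (fun x => ∏ j ∈ Finset.Icc 1 k, φ.sigma j x) *
        (μHE[k] : Measure (Rn n)) R.carrier := by
  rw [hRS.1, R.measure_image_eq_lintegral φ.contDiffOn φ.contDiffOn_symm F.isCompact
    φ.subset_source hR, ← setLIntegral_const]
  refine lintegral_mono_ae ?_
  filter_upwards [R.ae_mem_reg] with x hx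
  obtain ⟨W, hW⟩ := R.isUnitSimple_of_mem_reg hx
  have hxF : x ∈ F := hR (R.reg_subset hx)
  refine le_trans (ENNReal.ofReal_le_ofReal ?_)
    (le_iSup₂ (f := fun x (_ : x ∈ F) => ENNReal.ofReal |∏ j ∈ Finset.Icc 1 k, φ.sigma j x|) x hxF)
  refine le_trans ?_ (le_abs_self _)
  rw [prod_sigma_Icc]
  exact (hW.mass_wedgeMap_mem_Icc (fderiv_injective φ.contDiffOn φ.contDiffOn_symm
    (φ.subset_source hxF))).2

/-- With `p` the product of the `k` smallest singular values, `1 ≤ p⁻¹ J` holds pointwise on the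
regular part; integrating over `R` gives the claim. -/
theorem IsOrientedImage.le_measure (hk : k ≤ n) (hRS : IsOrientedImage φ R S)
    (hR : R.carrier ⊆ F) :
    (μHE[k] : Measure (Rn n)) R.carrier ≤
      supNorm F (fun x => ∏ j ∈ Finset.Icc (n - k + 1) n, (φ.sigma j x)⁻¹) *
        (μHE[k] : Measure (Rn n)) S.carrier := by
  have hJm := (R.aemeasurable_jacobian φ.contDiffOn (hR.trans φ.subset_source)).ennreal_ofReal
  rw [hRS.1, R.measure_image_eq_lintegral φ.contDiffOn φ.contDiffOn_symm F.isCompact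
    φ.subset_source hR, ← lintegral_const_mul'' _ hJm, ← setLIntegral_one]
  refine lintegral_mono_ae ?_
  filter_upwards [R.ae_mem_reg] with x hx
  obtain ⟨W, hW⟩ := R.isUnitSimple_of_mem_reg hx
  have hxF : x ∈ F := hR (R.reg_subset hx)
  have hinj : Function.Injective (φ.D x) := fderiv_injective φ.contDiffOn φ.contDiffOn_symm
    (φ.subset_source hxF)
  set p := ∏ i ∈ Finset.range k, (φ.D x : Rn n →ₗ[ℝ] Rn n).singularValues (n - k + i) with hp
  -- The indices `n - k + i` stay below `n` because `k ≤ n`, and injectivity makes all those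
  -- singular values positive.
  have hp0 : 0 < p := Finset.prod_pos fun i hi =>
    ((φ.D x : Rn n →ₗ[ℝ] Rn n).injective_iff_forall_lt_finrank_singularValues_pos.1 hinj) _ (by
      rw [Finset.mem_range] at hi
      simp only [finrank_euclideanSpace, Fintype.card_fin]
      omega)
  have hpJ : p ≤ jacobian φ.toHomeo R.orientation x := (hW.mass_wedgeMap_mem_Icc hinj).1
  calc (1 : ℝ≥0∞) = ENNReal.ofReal (p⁻¹ * p) := by
        rw [inv_mul_cancel₀ hp0.ne', ENNReal.ofReal_one]
    _ = ENNReal.ofReal p⁻¹ * ENNReal.ofReal p := ENNReal.ofReal_mul (inv_nonneg.2 hp0.le)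
    _ ≤ _ := by
      gcongr
      refine le_trans (ENNReal.ofReal_le_ofReal ?_) (le_iSup₂ (f := fun x (_ : x ∈ F) =>
        ENNReal.ofReal |∏ j ∈ Finset.Icc (n - k + 1) n, (φ.sigma j x)⁻¹|) x hxF)
      rw [prod_sigma_inv_Icc hk]
      exact le_abs_self _

end Transfer

/-! ### Unisolvence, Lagrange bases and Lebesgue constants under pullback. -/

section Lebesgue

variable {n k N : ℕ} {F E : Compacts (Rn n)}

theorem lagrangeBasis_mem {V : Submodule ℝ (TestForm k E)} {T : Fin N → TestForm k E →ₗ[ℝ] ℝ}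
    (h : IsUnisolvent V T) (j : Fin N) : lagrangeBasis h j ∈ V :=
  ((h.existsUnique j).choose : V).2

theorem apply_lagrangeBasis {V : Submodule ℝ (TestForm k E)} {T : Fin N → TestForm k E →ₗ[ℝ] ℝ}
    (h : IsUnisolvent V T) (i j : Fin N) : T i (lagrangeBasis h j) = if i = j then 1 else 0 :=
  (h.existsUnique j).choose_spec.1 i

theorem eq_lagrangeBasis {V : Submodule ℝ (TestForm k E)} {T : Fin N → TestForm k E →ₗ[ℝ] ℝ}
    (h : IsUnisolvent V T) {j : Fin N} {ω : TestForm k E} (hω : ω ∈ V)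
    (hT : ∀ i, T i ω = if i = j then 1 else 0) : ω = lagrangeBasis h j := by
  refine sub_eq_zero.1 (h.2.2 _ (V.sub_mem hω (lagrangeBasis_mem h j)) fun i => ?_)
  rw [map_sub, hT, apply_lagrangeBasis, sub_self]

theorem OrientedRectifiable.toReal_measure_pos (R : OrientedRectifiable n k) :
    0 < ((μHE[k] : Measure (Rn n)) R.carrier).toReal :=
  ENNReal.toReal_pos R.pos.ne' R.finite.ne

/-- The ratio `ℋ^k(S) / ℋ^k(R)`. -/
noncomputable def measureRatio (R S : OrientedRectifiable n k) : ℝ :=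
  ((μHE[k] : Measure (Rn n)) S.carrier).toReal / ((μHE[k] : Measure (Rn n)) R.carrier).toReal

theorem measureRatio_pos (R S : OrientedRectifiable n k) : 0 < measureRatio R S :=
  div_pos S.toReal_measure_pos R.toReal_measure_pos

theorem ofReal_measureRatio_le {R S : OrientedRectifiable n k} {A : ℝ≥0∞}
    (h : (μHE[k] : Measure (Rn n)) S.carrier ≤ A * (μHE[k] : Measure (Rn n)) R.carrier) :
    ENNReal.ofReal (measureRatio R S) ≤ A := by
  rw [measureRatio, ENNReal.ofReal_div_of_pos R.toReal_measure_pos,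
    ENNReal.ofReal_toReal S.finite.ne, ENNReal.ofReal_toReal R.finite.ne]
  exact ENNReal.div_le_of_le_mul h

theorem IsOrientedImage.avgCurrent_pullback {φ : C1Diffeo F E} {R S : OrientedRectifiable n k}
    (hRS : IsOrientedImage φ R S) (hR : R.carrier ⊆ F) (ω : TestForm k E) :
    avgCurrent R F (φ.pullback k ω) = measureRatio R S * avgCurrent S E ω := by
  change (((μHE[k] : Measure (Rn n)) R.carrier).toReal)⁻¹ * integralForm R (φ.pullback k ω) =
    measureRatio R S * ((((μHE[k] : Measure (Rn n)) S.carrier).toReal)⁻¹ * integralForm S ω)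
  rw [hRS.integralForm_eq hR, measureRatio]
  have h1 := S.toReal_measure_pos.ne'
  have h2 := R.toReal_measure_pos.ne'
  field_simp

variable {φ : C1Diffeo F E} {V : Submodule ℝ (TestForm k E)}
  {R S : Fin N → OrientedRectifiable n k}

/-- The functionals differ only by positive factors, so unisolvence on `E` shows at once that
pullback is injective on `V`, which preserves the dimension, and that the pulled-back family is
determining. -/
theorem IsUnisolvent.pullback (hT : IsUnisolvent V fun i => avgCurrent (S i) E)
    (hR : ∀ i, (R i).carrier ⊆ F) (hRS : ∀ i, IsOrientedImage φ (R i) (S i)) :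
    IsUnisolvent (V.map (φ.pullback k)) fun i => avgCurrent (R i) F := by
  obtain ⟨hfd, hN, hdet⟩ := hT
  have hzero : ∀ ω ∈ V, (∀ i, avgCurrent (R i) F (φ.pullback k ω) = 0) → ω = 0 := by
    refine fun ω hω h0 => hdet ω hω fun i => ?_
    have h1 := h0 i
    rw [(hRS i).avgCurrent_pullback (hR i)] at h1
    exact (mul_eq_zero.1 h1).resolve_left (measureRatio_pos _ _).ne'
  have hinj : Function.Injective ((φ.pullback k).domRestrict V) := by
    refine (injective_iff_map_eq_zero _).2 fun ω hω => Subtype.ext (hzero ω ω.2 fun i => ?_)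
    have h1 : φ.pullback k (ω : TestForm k E) = 0 := hω
    rw [h1, map_zero]
  refine ⟨inferInstance, ?_, ?_⟩
  · rw [← hN, ← LinearMap.range_domRestrict, LinearMap.finrank_range_of_inj hinj]
  · rintro _ ⟨ω, hω, rfl⟩ h0
    rw [hzero ω hω h0, map_zero]

theorem lagrangeBasis_pullback (hT : IsUnisolvent V fun i => avgCurrent (S i) E)
    (hThat : IsUnisolvent (V.map (φ.pullback k)) fun i => avgCurrent (R i) F)
    (hR : ∀ i, (R i).carrier ⊆ F) (hRS : ∀ i, IsOrientedImage φ (R i) (S i)) (j : Fin N) :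
    φ.pullback k (lagrangeBasis hT j) = measureRatio (R j) (S j) • lagrangeBasis hThat j := by
  have hpos := measureRatio_pos (R j) (S j)
  have h1 : (measureRatio (R j) (S j))⁻¹ • φ.pullback k (lagrangeBasis hT j) =
      lagrangeBasis hThat j := by
    refine eq_lagrangeBasis hThat (Submodule.smul_mem _ _
      (Submodule.mem_map_of_mem (lagrangeBasis_mem hT j))) fun i => ?_
    rw [map_smul, (hRS i).avgCurrent_pullback (hR i)]
    have h2 := apply_lagrangeBasis hT i j
    rw [h2, smul_eq_mul]
    split_ifs with hij
    · rw [hij, mul_one, inv_mul_cancel₀ hpos.ne']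
    · simp
  rw [← h1, smul_smul, mul_inv_cancel₀ hpos.ne', one_smul]

/-- Every competitor `S'` in `E` comes from a competitor `R'` in `F`. The ratio for the pair `S'`,
`R'` contributes `B`, and the ratios in the Lagrange bases contribute `A`. -/
theorem lebesgueConstant_le (hk : k ≤ n) (hT : IsUnisolvent V fun i => avgCurrent (S i) E)
    (hThat : IsUnisolvent (V.map (φ.pullback k)) fun i => avgCurrent (R i) F)
    (hR : ∀ i, (R i).carrier ⊆ F) (hRS : ∀ i, IsOrientedImage φ (R i) (S i)) :
    lebesgueConstant hT ≤
      supNorm F (fun x => ∏ j ∈ Finset.Icc 1 k, φ.sigma j x) *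
        supNorm F (fun x => ∏ j ∈ Finset.Icc (n - k + 1) n, (φ.sigma j x)⁻¹) *
        lebesgueConstant hThat := by
  set A := supNorm F (fun x => ∏ j ∈ Finset.Icc 1 k, φ.sigma j x)
  set B := supNorm F (fun x => ∏ j ∈ Finset.Icc (n - k + 1) n, (φ.sigma j x)⁻¹)
  refine iSup₂_le fun S' hS' => ?_
  obtain ⟨R', hR', hRS'⟩ := φ.exists_isOrientedImage S' hS'
  have hterm : ∀ i, avgCurrent S' E (lagrangeBasis hT i) = measureRatio S' R' *
      (measureRatio (R i) (S i) * avgCurrent R' F (lagrangeBasis hThat i)) := by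
    intro i
    have h1 := hRS'.avgCurrent_pullback hR' (lagrangeBasis hT i)
    rw [lagrangeBasis_pullback hT hThat hR hRS, map_smul, smul_eq_mul] at h1
    rw [h1, ← mul_assoc]
    -- The transfer runs from `E` back to `F` here, so the inverse ratio `ℋ^k(R') / ℋ^k(S')`
    -- appears; this is where the smallest singular values enter.
    have h2 : measureRatio S' R' * measureRatio R' S' = 1 := by
      rw [measureRatio, measureRatio]
      have h3 := S'.toReal_measure_pos.ne'
      have h4 := R'.toReal_measure_pos.ne'
      field_simp
    rw [h2, one_mul]
  have hA : ∀ i, ENNReal.ofReal (measureRatio (R i) (S i)) ≤ A := fun i =>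
    ofReal_measureRatio_le ((hRS i).measure_le (hR i))
  have hB : ENNReal.ofReal (measureRatio S' R') ≤ B :=
    ofReal_measureRatio_le (hRS'.le_measure hk hR')
  calc ENNReal.ofReal (∑ i, |avgCurrent S' E (lagrangeBasis hT i)|)
      = ∑ i, ENNReal.ofReal |avgCurrent S' E (lagrangeBasis hT i)| :=
        ENNReal.ofReal_sum_of_nonneg fun _ _ => abs_nonneg _
    _ ≤ ∑ i, A * B * ENNReal.ofReal |avgCurrent R' F (lagrangeBasis hThat i)| := by
        refine Finset.sum_le_sum fun i _ => ?_
        rw [hterm, abs_mul, abs_mul, abs_of_pos (measureRatio_pos _ _),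
          abs_of_pos (measureRatio_pos _ _), ENNReal.ofReal_mul (measureRatio_pos _ _).le,
          ENNReal.ofReal_mul (measureRatio_pos _ _).le, ← mul_assoc, mul_comm A B]
        gcongr
        exact hA i
    _ = A * B * ENNReal.ofReal (∑ i, |avgCurrent R' F (lagrangeBasis hThat i)|) := by
        rw [← Finset.mul_sum, ENNReal.ofReal_sum_of_nonneg fun _ _ => abs_nonneg _]
    _ ≤ A * B * lebesgueConstant hThat := by
        gcongr
        exact le_iSup₂ (f := fun (T : OrientedRectifiable n k) (_ : T.carrier ⊆ F) =>
          ENNReal.ofReal (∑ i, |avgCurrent T F (lagrangeBasis hThat i)|)) R' hR'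

end Lebesgue

end FormInterp

theorem mainTheorem3 {n k N : ℕ} (hk : k ≤ n)
    (Ehat E : TopologicalSpace.Compacts (FormInterp.Rn n))
    (hEhat : closure (interior (Ehat : Set (FormInterp.Rn n))) = Ehat)
    (φ : FormInterp.C1Diffeo Ehat E)
    (V : Submodule ℝ (FormInterp.TestForm k E))
    (Shat S : Fin N → FormInterp.OrientedRectifiable n k)
    (hShat : ∀ i, (Shat i).carrier ⊆ Ehat)
    (hS : ∀ i, FormInterp.IsOrientedImage φ (Shat i) (S i))
    (hT : FormInterp.IsUnisolvent V fun i => FormInterp.avgCurrent (S i) E) :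
    ∃ hThat : FormInterp.IsUnisolvent (V.map (φ.pullback k))
        fun i => FormInterp.avgCurrent (Shat i) Ehat,
      FormInterp.lebesgueConstant hT ≤
        FormInterp.supNorm Ehat (fun x => ∏ j ∈ Finset.Icc 1 k, φ.sigma j x) *
          FormInterp.supNorm Ehat
            (fun x => ∏ j ∈ Finset.Icc (n - k + 1) n, (φ.sigma j x)⁻¹) *
          FormInterp.lebesgueConstant hThat := by
  have hThat := hT.pullback hShat hS
  exact ⟨hThat, FormInterp.lebesgueConstant_le hk hT hThat hShat hS⟩
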